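/- Let $\lambda>1$ and, for $B\in\{1,-1\}$, consider in the half-plane $x>0$ the Hamiltonian system $$x'=y,\qquad y'=-\lambda^2x+\frac{\lambda-1}{\lambda}\,B\,x^{\frac{\lambda-2}{\lambda}},$$ whose conserved Hamiltonian (the pressure) is $P=-\frac{y^2}{2}-\frac{\lambda^2}{2}x^2+\frac B2x^{\frac{2\lambda-2}{\lambda}}$. Put $P_{\max}=\frac1{2\lambda}\left(\frac{\lambda-1}{\lambda^3}\right)^{\lambda-1}$. An elliptic orbit is a solution defined, with $x>0$, for all times; a hyperbolic orbit is a solution with $x>0$ on a bounded open interval $(a,b)$, with $x$ continuous on $[a,b]$ and $x(a)=x(b)=0$; its life-span is $b-a$. For $B=1$ and $0<P<P_{\max}$ there are elliptic orbits of pressure $P$, and all of them are periodic with the same least period, denoted $T_\lambda(P,1)$. For $P<0$ and $B=\pm1$ there are hyperbolic orbits of pressure $P$, and all of them have the same life-span, denoted $T_\lambda(P,B)$. These functions satisfy the following. (i) Elliptic case. Let $\lambda\ge\frac43$. As $P$ decreases from $P_{\max}$ to $0$, $T_\lambda(P,1)$ changes continuously and monotonically from $\frac{2\pi}{\sqrt{2\lambda}}$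 (its limit as $P\to P_{\max}^-$) to $\pi$ (its limit as $P\to0^+$): it is strictly increasing (as $P$ decreases) if $\lambda>2$, strictly decreasing (as $P$ decreases) if $\frac43\le\lambda<2$, and identically equal to $\pi$ if $\lambda=2$. (ii) Hyperbolic case. Let $\lambda>1$. As $P$ decreases from $0$ to $-\infty$, $T_\lambda(P,1)$ is continuous and strictly decreases from $\pi$ (its limit as $P\to0^-$) to $\frac{\pi}{\lambda}$ (its limit as $P\to-\infty$), while $T_\lambda(P,-1)$ is continuous and strictly increases from $0$ (its limit as $P\to0^-$) to $\frac{\pi}{\lambda}$ (its limit as $P\to-\infty$). -/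

import Mathlib

open Set Filter Topology

noncomputable section

namespace HomEuler

/-- The pressure Hamiltonian `P(x,y) = -y²/2 - λ²x²/2 + (B/2) x^((2λ-2)/λ)`. -/
def pressure (lam B x y : ℝ) : ℝ :=
  -(y ^ 2) / 2 - lam ^ 2 / 2 * x ^ 2 + B / 2 * x ^ ((2 * lam - 2) / lam)

/-- `(x,y)` is, on the (open) time set `s`, a solution of the Hamiltonian system
`x' = y`, `y' = -λ² x + ((λ-1)/λ) B x^((λ-2)/λ)` lying in the open right half-plane `x > 0`. -/
structure IsSolution (lam B : ℝ) (x y : ℝ → ℝ) (s : Set ℝ) : Prop where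
  pos : ∀ t ∈ s, 0 < x t
  deriv_x : ∀ t ∈ s, HasDerivAt x (y t) t
  deriv_y : ∀ t ∈ s,
    HasDerivAt y (-lam ^ 2 * x t + (lam - 1) / lam * B * (x t) ^ ((lam - 2) / lam)) t

/-- An elliptic orbit at pressure `P`: a global solution that never vanishes. -/
def IsEllipticOrbit (lam P B : ℝ) (x y : ℝ → ℝ) : Prop :=
  IsSolution lam B x y univ ∧ ∀ t, pressure lam B (x t) (y t) = P

/-- A hyperbolic orbit at pressure `P` with life-time `(a,b)`: a solution that is positive on
`(a,b)` and vanishes (continuously) at both end-points. -/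
def IsHyperbolicOrbit (lam P B a b : ℝ) (x y : ℝ → ℝ) : Prop :=
  a < b ∧ IsSolution lam B x y (Ioo a b) ∧
    (∀ t ∈ Ioo a b, pressure lam B (x t) (y t) = P) ∧
    ContinuousOn x (Icc a b) ∧ x a = 0 ∧ x b = 0

/-- `T` is the period of the elliptic orbits at `(P,B)`: there are such orbits, and each of them
is periodic with least positive period `T`. -/
def IsPeriod (lam P B T : ℝ) : Prop :=
  (∃ x y : ℝ → ℝ, IsEllipticOrbit lam P B x y) ∧
    ∀ x y : ℝ → ℝ, IsEllipticOrbit lam P B x y →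
      IsLeast {τ : ℝ | 0 < τ ∧ Function.Periodic x τ ∧ Function.Periodic y τ} T

/-- `T` is the life-span of the hyperbolic orbits at `(P,B)`: there are such orbits, and the
life-time of each of them has length `T`. -/
def IsLifeSpan (lam P B T : ℝ) : Prop :=
  (∃ (a b : ℝ) (x y : ℝ → ℝ), IsHyperbolicOrbit lam P B a b x y) ∧
    ∀ (a b : ℝ) (x y : ℝ → ℝ), IsHyperbolicOrbit lam P B a b x y → b - a = T

/-- The pressure at the steady state `x = ((λ-1)/λ³)^(λ/2)`, `y = 0` of the system with `B = 1`. -/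
def pMax (lam : ℝ) : ℝ := 1 / (2 * lam) * ((lam - 1) / lam ^ 3) ^ (lam - 1)

end HomEuler

end

/-! Write γ = (2λ-2)/λ. In both cases suitable coordinates turn the energy level into a circle on
which the angle grows at a positive speed that depends only on position. The period or life-span is
then the integral of the reciprocal speed over a full turn or a half turn (`exists_angle`,
`exists_shift`). This gives existence, uniqueness up to a time shift and the common duration at
once.

Elliptic case. Let V be the potential energy above the steady state. Take H = ±√(2V(x)) (`coord`) as
the new coordinate, so that H² + y² = r² with r² = 2(P_max - P). The angular speed is H'(x), so the
period is the integral of `tempo` (r sin θ) over [0, 2π], where `tempo` = dx/dH. Pairing θ with -θ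
leaves the even part of `tempo`, and its derivative compares N = (V/V'²)' at two points on opposite
sides of the steady state. By Chicone's criterion the period is therefore monotone in r as soon as
V/V'² is strictly convex or strictly concave. The sign of the second derivative is that of
`chiconeK`, settled in `chiconeK_pos` and `chiconeK_neg`. For λ = 2 the system is a shifted harmonic
oscillator. As r → 0 the period tends to 2π/√V'' at the steady state, where V'' = 2λ. As P → 0 the
substitution u = λ x^(1/λ) turns the limiting motion into u'² = 1 - u², with duration π.

Hyperbolic case. Let r be the turning point and put m = B r^(-2/λ)/λ². The energy law factors as y²
= λ²(1 - m q(x/r))(r² - x²), where q(ξ) = (1 - ξ^γ)/(1 - ξ²) lies in (0, 1] for ξ ≥ 0 (`energy_eq`).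
The life-span is thus a function of m alone (`lifeSpan`). It increases strictly on m < 1, from 0 at
-∞ through π/λ at 0 to π at 1. What remains is that m increases from 0 to 1 (B = 1), or decreases
from 0 to -∞ (B = -1), as P runs from -∞ to 0. -/

noncomputable section

namespace HomEuler

/-! ### Inverse functions, derivatives across isolated points, and rotation on a circle -/

section


/-- A strictly increasing continuous function with range `ℝ` has a continuous inverse. -/
lemma exists_inverse {E : ℝ → ℝ} (hE : StrictMono E) (hc : Continuous E)
    (ht : Tendsto E atTop atTop) (hb : Tendsto E atBot atBot) :
    ∃ R : ℝ → ℝ, Continuous R ∧ StrictMono R ∧ (∀ x, R (E x) = x) ∧ (∀ p, E (R p) = p) ∧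
      Tendsto R atTop atTop := by
  have hs : Function.Surjective E := hc.surjective ht hb
  let e := hE.orderIsoOfSurjective E hs
  refine ⟨e.symm, e.symm.continuous, e.symm.strictMono, fun x => e.symm_apply_apply x,
    fun p => e.apply_symm_apply p, e.symm.tendsto_atTop⟩

lemma exists_inverse_Ici {E : ℝ → ℝ} {a : ℝ} (hE : StrictMonoOn E (Ici a))
    (hc : ContinuousOn E (Ici a)) (ht : Tendsto E atTop atTop) :
    ∃ R : ℝ → ℝ, Continuous R ∧ StrictMono R ∧ (∀ x, a ≤ x → R (E x) = x) ∧
      (∀ p, E a ≤ p → a ≤ R p ∧ E (R p) = p) ∧ Tendsto R atTop atTop := by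
  -- Continuing `E` to the left of `a` by a line of slope 1 gives an increasing bijection of ℝ, so
  -- the inverse is continuous everywhere and needs no care at the endpoint.
  set G : ℝ → ℝ := fun x => E (max x a) + (min x a - a) with hG
  have hGe : ∀ x, a ≤ x → G x = E x := by
    intro x hx
    simp [hG, hx]
  have hGl : ∀ x, x ≤ a → G x = E a + (x - a) := by
    intro x hx
    simp [hG, hx]
  have hmono : StrictMono G := by
    intro x y hxy
    rcases le_total y a with hy | hy
    · rw [hGl x (hxy.le.trans hy), hGl y hy]
      linarith
    rcases le_total x a with hx | hx
    · rw [hGl x hx, hGe y hy]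
      have h1 : E a ≤ E y := hE.monotoneOn (mem_Ici.2 le_rfl) (mem_Ici.2 hy) hy
      rcases hx.lt_or_eq with h | h
      · linarith
      · subst h
        have := hE (mem_Ici.2 le_rfl) (mem_Ici.2 hy) hxy
        linarith
    · rw [hGe x hx, hGe y hy]
      exact hE (mem_Ici.2 hx) (mem_Ici.2 hy) hxy
  have hcont : Continuous G := by
    have : Continuous fun x => E (max x a) :=
      hc.comp_continuous (by fun_prop) (fun x => le_max_right x a)
    exact this.add (by fun_prop)
  have htop : Tendsto G atTop atTop :=
    ht.congr' ((eventually_ge_atTop a).mono fun x hx => (hGe x hx).symm)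
  have hbot : Tendsto G atBot atBot := by
    have : Tendsto (fun x => E a + (x - a)) atBot atBot :=
      tendsto_atBot_add_const_left _ _ (tendsto_atBot_add_const_right _ _ tendsto_id)
    exact this.congr' ((eventually_le_atBot a).mono fun x hx => (hGl x hx).symm)
  obtain ⟨R, hR1, hR2, hR3, hR4, hR5⟩ := exists_inverse hmono hcont htop hbot
  refine ⟨R, hR1, hR2, fun x hx => by rw [← hGe x hx, hR3], fun p hp => ?_, hR5⟩
  have h1 : a ≤ R p := by
    have := hR2.monotone hp
    rwa [← hGe a le_rfl, hR3] at this
  exact ⟨h1, by rw [← hGe _ h1, hR4]⟩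

/-- A continuous function whose derivative extends continuously across an isolated point. -/
lemma hasDerivAt_of_punctured {u v : ℝ → ℝ} {t : ℝ} (hu : ContinuousAt u t)
    (hv : ContinuousAt v t) (hd : ∀ᶠ s in 𝓝[≠] t, HasDerivAt u (v s) s) :
    HasDerivAt u (v t) t := by
  rw [eventually_nhdsWithin_iff, Metric.eventually_nhds_iff] at hd
  obtain ⟨ε, hε, hd⟩ := hd
  have hd' : ∀ s, |s - t| < ε → s ≠ t → HasDerivAt u (v s) s := fun s hs hne =>
    hd (by rwa [Real.dist_eq]) hne
  have hR : HasDerivWithinAt u (v t) (Ici t) t := by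
    have hdr : ∀ s ∈ Ioo t (t + ε), HasDerivAt u (v s) s := fun s hs =>
      hd' s (by rw [abs_lt]; constructor <;> linarith [hs.1, hs.2]) hs.1.ne'
    refine hasDerivWithinAt_Ici_of_tendsto_deriv (s := Ioo t (t + ε))
      (fun s hs => (hdr s hs).differentiableAt.differentiableWithinAt) hu.continuousWithinAt
      (Ioo_mem_nhdsGT (by linarith)) ?_
    have h2 : Tendsto v (𝓝[>] t) (𝓝 (v t)) := hv.tendsto.mono_left nhdsWithin_le_nhds
    refine h2.congr' ?_
    filter_upwards [Ioo_mem_nhdsGT (show t < t + ε by linarith)] with s hs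
    exact (hdr s hs).deriv.symm
  have hL : HasDerivWithinAt u (v t) (Iic t) t := by
    have hdl : ∀ s ∈ Ioo (t - ε) t, HasDerivAt u (v s) s := fun s hs =>
      hd' s (by rw [abs_lt]; constructor <;> linarith [hs.1, hs.2]) hs.2.ne
    refine hasDerivWithinAt_Iic_of_tendsto_deriv (s := Ioo (t - ε) t)
      (fun s hs => (hdl s hs).differentiableAt.differentiableWithinAt) hu.continuousWithinAt
      (Ioo_mem_nhdsLT (by linarith)) ?_
    have h2 : Tendsto v (𝓝[<] t) (𝓝 (v t)) := hv.tendsto.mono_left nhdsWithin_le_nhds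
    refine h2.congr' ?_
    filter_upwards [Ioo_mem_nhdsLT (show t - ε < t by linarith)] with s hs
    exact (hdl s hs).deriv.symm
  have := hL.union hR
  rwa [Iic_union_Ici, hasDerivWithinAt_univ] at this

/-- Recovering the derivative of `u` from that of `u ^ 2`, across an isolated zero of `u`. -/
lemma hasDerivAt_of_sq {u v : ℝ → ℝ} {t : ℝ} (hu : ∀ᶠ s in 𝓝 t, ContinuousAt u s)
    (hd : ∀ᶠ s in 𝓝 t, HasDerivAt (fun s => u s ^ 2) (2 * u s * v s) s)
    (h0 : ∀ᶠ s in 𝓝[≠] t, u s ≠ 0) (hv : ContinuousAt v t) : HasDerivAt u (v t) t := by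
  refine hasDerivAt_of_punctured hu.self_of_nhds hv ?_
  filter_upwards [h0, hu.filter_mono nhdsWithin_le_nhds, hd.filter_mono nhdsWithin_le_nhds]
    with s hs hus hds
  have key : HasDerivAt (fun s => √(u s ^ 2)) (2 * u s * v s / (2 * √(u s ^ 2))) s :=
    hds.sqrt (by positivity)
  rcases lt_or_gt_of_ne hs with h | h
  · have he : (fun s => - √(u s ^ 2)) =ᶠ[𝓝 s] u := by
      filter_upwards [hus.eventually_lt_const h] with w hw
      rw [Real.sqrt_sq_eq_abs, abs_of_neg hw, neg_neg]
    have := key.neg.congr_of_eventuallyEq he.symm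
    refine this.congr_deriv ?_
    rw [Real.sqrt_sq_eq_abs, abs_of_neg h]
    field_simp
  · have he : (fun s => √(u s ^ 2)) =ᶠ[𝓝 s] u := by
      filter_upwards [hus.eventually_const_lt h] with w hw
      rw [Real.sqrt_sq_eq_abs, abs_of_pos hw]
    have := key.congr_of_eventuallyEq he.symm
    refine this.congr_deriv ?_
    rw [Real.sqrt_sq_eq_abs, abs_of_pos h]
    field_simp

/-- For a continuous positive `2π`-periodic density `D`, the angle as a function of the time
`∫ φ in 0..θ, D φ`. -/
lemma exists_angle {D : ℝ → ℝ} (hD : Continuous D) (hpos : ∀ θ, 0 < D θ)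
    (hper : Function.Periodic D (2 * Real.pi)) :
    ∃ A : ℝ → ℝ, Continuous A ∧ StrictMono A ∧ (∀ θ, A (∫ φ in (0:ℝ)..θ, D φ) = θ) ∧
      (∀ t, ∫ φ in (0:ℝ)..(A t), D φ = t) ∧ ∀ t, HasDerivAt A (D (A t))⁻¹ t := by
  set τ : ℝ → ℝ := fun θ => ∫ φ in (0:ℝ)..θ, D φ with hτ
  have hτd : ∀ θ, HasDerivAt τ (D θ) θ := fun θ =>
    intervalIntegral.integral_hasDerivAt_right (hD.intervalIntegrable _ _)
      (hD.stronglyMeasurableAtFilter _ _) hD.continuousAt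
  have hmono : StrictMono τ := strictMono_of_hasDerivAt_pos hτd hpos
  have hpi : (0:ℝ) < 2 * Real.pi := by positivity
  have hint : 0 < ∫ x in (0:ℝ)..(2 * Real.pi), D x :=
    intervalIntegral.intervalIntegral_pos_of_pos (hD.intervalIntegrable _ _) hpos hpi
  have hii : ∀ t₁ t₂, IntervalIntegrable D MeasureTheory.volume t₁ t₂ :=
    fun _ _ => hD.intervalIntegrable _ _
  have htop := hper.tendsto_atTop_intervalIntegral_of_pos' (hii _ _) hpos hpi
  have hbot := hper.tendsto_atBot_intervalIntegral_of_pos' (hii _ _) hpos hpi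
  obtain ⟨A, hA1, hA2, hA3, hA4, -⟩ := exists_inverse hmono
    (continuous_iff_continuousAt.2 fun θ => (hτd θ).continuousAt) htop hbot
  exact ⟨A, hA1, hA2, hA3, hA4, fun t => (hτd (A t)).of_local_left_inverse hA1.continuousAt
    (hpos _).ne' (Eventually.of_forall hA4)⟩

/-- The time needed to gain an angle `p` is the same from every starting angle, since the integral
of `D` over any interval of length `p` is the same. -/
lemma angle_add_period {D A : ℝ → ℝ} (hD : Continuous D)
    (hA : ∀ θ, A (∫ φ in (0:ℝ)..θ, D φ) = θ) (hA' : ∀ t, ∫ φ in (0:ℝ)..(A t), D φ = t) {p : ℝ}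
    (hper : Function.Periodic D p) (t : ℝ) : A (t + ∫ φ in (0:ℝ)..p, D φ) = A t + p := by
  rw [← hA (A t + p)]
  congr 1
  have h1 := intervalIntegral.integral_add_adjacent_intervals
    (hD.intervalIntegrable (μ := MeasureTheory.volume) 0 (A t))
    (hD.intervalIntegrable (A t) (A t + p))
  rw [← h1, hA', hper.intervalIntegral_add_eq (A t) 0, zero_add]

/-- A planar motion on a circle with positive continuous angular speed lifts to an angle. -/
lemma exists_lift {s : Set ℝ} (hs : IsOpen s) (hc : s.OrdConnected) {t₀ : ℝ} (ht₀ : t₀ ∈ s)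
    {H z w : ℝ → ℝ} {r : ℝ} (hr : 0 < r) (hw : ContinuousOn w s)
    (hH : ∀ t ∈ s, HasDerivAt H (w t * z t) t) (hz : ∀ t ∈ s, HasDerivAt z (-(w t * H t)) t)
    (h0 : H t₀ ^ 2 + z t₀ ^ 2 = r ^ 2) :
    ∃ Θ : ℝ → ℝ, ∀ t ∈ s, HasDerivAt Θ (w t) t ∧ H t = r * Real.sin (Θ t) ∧
      z t = r * Real.cos (Θ t) := by
  obtain ⟨φ, hφ1, hφ2⟩ : ∃ φ, H t₀ = r * Real.sin φ ∧ z t₀ = r * Real.cos φ := by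
    have hn : ‖(⟨z t₀, H t₀⟩ : ℂ)‖ = r := by
      rw [Complex.norm_def, Complex.normSq_mk, ← Real.sqrt_sq hr.le, ← h0]
      congr 1
      ring
    refine ⟨Complex.arg ⟨z t₀, H t₀⟩, ?_, ?_⟩
    · have := Complex.norm_mul_sin_arg ⟨z t₀, H t₀⟩
      rw [hn] at this
      exact this.symm
    · have := Complex.norm_mul_cos_arg ⟨z t₀, H t₀⟩
      rw [hn] at this
      exact this.symm
  set Θ : ℝ → ℝ := fun t => φ + ∫ σ in t₀..t, w σ with hΘ
  have hΘd : ∀ t ∈ s, HasDerivAt Θ (w t) t := by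
    intro t ht
    refine HasDerivAt.const_add φ (intervalIntegral.integral_hasDerivAt_right ?_ ?_ ?_)
    · exact (hw.mono (hc.uIcc_subset ht₀ ht)).intervalIntegrable
    · exact hw.stronglyMeasurableAtFilter hs t ht
    · exact hw.continuousAt (hs.mem_nhds ht)
  have hΘ0 : Θ t₀ = φ := by simp [hΘ]
  -- the motion rotated back by `Θ` is constant
  set C : ℝ → ℝ := fun t => z t * Real.cos (Θ t) + H t * Real.sin (Θ t) with hC
  set S : ℝ → ℝ := fun t => H t * Real.cos (Θ t) - z t * Real.sin (Θ t) with hS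
  have hCd : ∀ t ∈ s, HasDerivAt C 0 t := by
    intro t ht
    have := ((hz t ht).mul (hΘd t ht).cos).add ((hH t ht).mul (hΘd t ht).sin)
    exact this.congr_deriv (by ring)
  have hSd : ∀ t ∈ s, HasDerivAt S 0 t := by
    intro t ht
    have := ((hH t ht).mul (hΘd t ht).cos).sub ((hz t ht).mul (hΘd t ht).sin)
    exact this.congr_deriv (by ring)
  have hconst : ∀ f : ℝ → ℝ, (∀ t ∈ s, HasDerivAt f 0 t) → ∀ t ∈ s, f t = f t₀ := by
    intro f hf t ht
    refine hs.is_const_of_deriv_eq_zero hc.isPreconnected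
      (fun t ht => (hf t ht).differentiableAt.differentiableWithinAt)
      (fun t ht => (hf t ht).deriv) ht ht₀
  refine ⟨Θ, fun t ht => ⟨hΘd t ht, ?_, ?_⟩⟩
  all_goals
    have h1 := hconst C hCd t ht
    have h2 := hconst S hSd t ht
    simp only [hC, hS, hΘ0, hφ1, hφ2] at h1 h2
    have h3 := Real.sin_sq_add_cos_sq φ
    have h4 := Real.sin_sq_add_cos_sq (Θ t)
  · linear_combination Real.sin (Θ t) * h1 + Real.cos (Θ t) * h2 + r * Real.sin (Θ t) * h3
      - H t * h4
  · linear_combination Real.cos (Θ t) * h1 - Real.sin (Θ t) * h2 + r * Real.cos (Θ t) * h3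
      - z t * h4

/-- If moreover the angular speed is a function of the angle, then the motion is, up to a time
shift, the one given by `exists_angle`. -/
lemma exists_shift {s : Set ℝ} (hs : IsOpen s) (hc : s.OrdConnected) {t₀ : ℝ} (ht₀ : t₀ ∈ s)
    {H z w : ℝ → ℝ} {r : ℝ} (hr : 0 < r) (hw : ContinuousOn w s)
    (hH : ∀ t ∈ s, HasDerivAt H (w t * z t) t) (hz : ∀ t ∈ s, HasDerivAt z (-(w t * H t)) t)
    (h0 : H t₀ ^ 2 + z t₀ ^ 2 = r ^ 2) {D A : ℝ → ℝ} (hD : Continuous D)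
    (hA : ∀ θ, A (∫ φ in (0:ℝ)..θ, D φ) = θ)
    (hwD : ∀ t ∈ s, ∀ θ, H t = r * Real.sin θ → D θ * w t = 1) :
    ∃ c, ∀ t ∈ s, H t = r * Real.sin (A (t + c)) ∧ z t = r * Real.cos (A (t + c)) := by
  obtain ⟨Θ, hΘ⟩ := exists_lift hs hc ht₀ hr hw hH hz h0
  set τ : ℝ → ℝ := fun θ => ∫ φ in (0:ℝ)..θ, D φ with hτ
  have hτd : ∀ θ, HasDerivAt τ (D θ) θ := fun θ =>
    intervalIntegral.integral_hasDerivAt_right (hD.intervalIntegrable _ _)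
      (hD.stronglyMeasurableAtFilter _ _) hD.continuousAt
  -- `D` is the reciprocal of the angular speed at the same angle, so `τ ∘ Θ` has derivative 1 and
  -- measures time up to a constant.
  have hd : ∀ t ∈ s, HasDerivAt (fun t => τ (Θ t) - t) 0 t := by
    intro t ht
    obtain ⟨h1, h2, -⟩ := hΘ t ht
    have := ((hτd (Θ t)).comp t h1).sub (hasDerivAt_id t)
    rw [hwD t ht _ h2, sub_self] at this
    exact this
  refine ⟨τ (Θ t₀) - t₀, fun t ht => ?_⟩
  have h1 : τ (Θ t) - t = τ (Θ t₀) - t₀ :=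
    hs.is_const_of_deriv_eq_zero hc.isPreconnected
      (fun t ht => (hd t ht).differentiableAt.differentiableWithinAt)
      (fun t ht => (hd t ht).deriv) ht ht₀
  have h2 : A (t + (τ (Θ t₀) - t₀)) = Θ t := by
    rw [← h1, add_sub_cancel]
    exact hA _
  rw [h2]
  exact (hΘ t ht).2

end

/-! ### The potential energy for `B = 1` and its derivatives -/

section


/-- The ratio of the two terms of the force, `((λ-1)/λ³) x^(-2/λ)`. -/
def forceRatio (l x : ℝ) : ℝ := (l - 1) / l ^ 3 * x ^ (-2 / l)

/-- The potential energy for `B = 1`, normalised to vanish at the steady state. -/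
def potential (l x : ℝ) : ℝ := l ^ 2 / 2 * x ^ 2 - 1 / 2 * x ^ ((2 * l - 2) / l) + pMax l

/-- The first derivative of `potential`. -/
def potentialD1 (l x : ℝ) : ℝ := l ^ 2 * x * (1 - forceRatio l x)

/-- The second derivative of `potential`. -/
def potentialD2 (l x : ℝ) : ℝ := l * (l - (l - 2) * forceRatio l x)

/-- The third derivative of `potential`. -/
def potentialD3 (l x : ℝ) : ℝ := 2 * (l - 2) * forceRatio l x / x

/-- The steady state. -/
def steady (l : ℝ) : ℝ := ((l - 1) / l ^ 3) ^ (l / 2)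

variable {l x : ℝ}

/-- Every power in the problem is reduced to x^(-2/λ), so that V and its derivatives become
algebraic in x and p = `forceRatio l x`. -/
lemma rpow_mass_exponent (hl : 1 < l) (hx : 0 < x) :
    x ^ ((2 * l - 2) / l) = x ^ 2 * x ^ (-2 / l) := by
  have : (2 * l - 2) / l = 2 + (-2 / l) := by field_simp; ring
  rw [this, Real.rpow_add hx, Real.rpow_two]

lemma rpow_force_exponent (hl : 1 < l) (hx : 0 < x) :
    x ^ ((l - 2) / l) = x * x ^ (-2 / l) := by
  have : (l - 2) / l = 1 + (-2 / l) := by field_simp; ring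
  rw [this, Real.rpow_add hx, Real.rpow_one]

lemma steady_pos (hl : 1 < l) : 0 < steady l :=
  Real.rpow_pos_of_pos (div_pos (by linarith) (by positivity)) _

lemma pMax_pos (hl : 1 < l) : 0 < pMax l :=
  mul_pos (by positivity) (Real.rpow_pos_of_pos (div_pos (by linarith) (by positivity)) _)

lemma forceRatio_pos (hl : 1 < l) (hx : 0 < x) : 0 < forceRatio l x :=
  mul_pos (div_pos (by linarith) (by positivity)) (Real.rpow_pos_of_pos hx _)

lemma forceRatio_lt (hl : 1 < l) {y : ℝ} (hx : 0 < x) (hxy : x < y) :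
    forceRatio l y < forceRatio l x := by
  have : -2 / l < 0 := div_neg_of_neg_of_pos (by norm_num) (by linarith)
  exact mul_lt_mul_of_pos_left (Real.rpow_lt_rpow_of_neg hx hxy this)
    (div_pos (by linarith) (by positivity))

lemma forceRatio_steady (hl : 1 < l) : forceRatio l (steady l) = 1 := by
  have h : 0 < (l - 1) / l ^ 3 := div_pos (by linarith) (by positivity)
  rw [forceRatio, steady, ← Real.rpow_mul h.le]
  have : l / 2 * (-2 / l) = -1 := by field_simp
  rw [this, Real.rpow_neg_one, mul_inv_cancel₀ h.ne']

lemma hasDerivAt_forceRatio (hx : 0 < x) :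
    HasDerivAt (forceRatio l) (-2 / l * forceRatio l x / x) x := by
  have := (Real.hasDerivAt_rpow_const (p := -2 / l) (Or.inl hx.ne')).const_mul ((l - 1) / l ^ 3)
  refine this.congr_deriv ?_
  rw [Real.rpow_sub_one hx.ne', forceRatio]
  ring

lemma potential_eq (hl : 1 < l) (hx : 0 < x) : potential l x =
    l ^ 2 / 2 * x ^ 2 * (1 - l / (l - 1) * forceRatio l x) + pMax l := by
  have : l - 1 ≠ 0 := by linarith
  rw [potential, rpow_mass_exponent hl hx, forceRatio]
  field_simp

lemma force_eq (hl : 1 < l) (hx : 0 < x) :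
    -l ^ 2 * x + (l - 1) / l * 1 * x ^ ((l - 2) / l) = -potentialD1 l x := by
  rw [rpow_force_exponent hl hx, potentialD1, forceRatio]
  field_simp
  ring

lemma hasDerivAt_potential (hl : 1 < l) (hx : 0 < x) :
    HasDerivAt (potential l) (potentialD1 l x) x := by
  have h1 := (Real.hasDerivAt_rpow_const (p := (2 * l - 2) / l) (Or.inl hx.ne')).const_mul (1 / 2)
  have h2 := (((hasDerivAt_pow 2 x).const_mul (l ^ 2 / 2)).sub h1).add_const (pMax l)
  refine h2.congr_deriv ?_
  rw [← neg_eq_iff_eq_neg.2 (force_eq hl hx)]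
  have : (2 * l - 2) / l - 1 = (l - 2) / l := by field_simp; ring
  rw [this]
  field_simp
  ring

lemma hasDerivAt_potentialD1 (hl : 1 < l) (hx : 0 < x) :
    HasDerivAt (potentialD1 l) (potentialD2 l x) x := by
  have := ((hasDerivAt_id x).const_mul (l ^ 2)).mul
    ((hasDerivAt_forceRatio (l := l) hx).const_sub 1)
  refine this.congr_deriv ?_
  rw [potentialD2]
  simp only [id]
  field_simp
  ring

lemma hasDerivAt_potentialD2 (hl : 1 < l) (hx : 0 < x) :
    HasDerivAt (potentialD2 l) (potentialD3 l x) x := by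
  have := (((hasDerivAt_forceRatio (l := l) hx).const_mul (l - 2)).const_sub l).const_mul l
  refine this.congr_deriv ?_
  rw [potentialD3]
  field_simp

lemma continuous_potential (hl : 1 < l) : Continuous (potential l) := by
  have : 0 ≤ (2 * l - 2) / l := div_nonneg (by linarith) (by linarith)
  unfold potential
  have := Real.continuous_rpow_const this
  fun_prop

lemma potential_zero (hl : 1 < l) : potential l 0 = pMax l := by
  have : (2 * l - 2) / l ≠ 0 := div_ne_zero (by linarith) (by linarith)
  simp [potential, Real.zero_rpow this]

/-- Links the constant in `pMax` with the steady state; this is what makes the normalised potential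
vanish there. -/
lemma steady_sq (hl : 1 < l) : steady l ^ 2 * l ^ 2 = 2 * (l - 1) * pMax l := by
  have h : 0 < (l - 1) / l ^ 3 := div_pos (by linarith) (by positivity)
  have hl1 : l - 1 ≠ 0 := by linarith
  rw [steady, pMax, ← Real.rpow_natCast, ← Real.rpow_mul h.le, Real.rpow_sub_one h.ne']
  have : l / 2 * ((2 : ℕ) : ℝ) = l := by push_cast; ring
  rw [this]
  field_simp

lemma potential_steady (hl : 1 < l) : potential l (steady l) = 0 := by
  have hl1 : l - 1 ≠ 0 := by linarith
  rw [potential_eq hl (steady_pos hl), forceRatio_steady hl]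
  have := steady_sq hl
  field_simp
  linear_combination -this

lemma potentialD1_pos (hl : 1 < l) (hx : steady l < x) : 0 < potentialD1 l x := by
  have h0 := (steady_pos hl).trans hx
  have := forceRatio_lt hl (steady_pos hl) hx
  rw [forceRatio_steady hl] at this
  exact mul_pos (by positivity) (by linarith)

lemma potentialD1_neg (hl : 1 < l) (h0 : 0 < x) (hx : x < steady l) : potentialD1 l x < 0 := by
  have := forceRatio_lt hl h0 hx
  rw [forceRatio_steady hl] at this
  exact mul_neg_of_pos_of_neg (by positivity) (by linarith)

lemma potentialD1_steady (hl : 1 < l) : potentialD1 l (steady l) = 0 := by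
  rw [potentialD1, forceRatio_steady hl]; ring

/-- The squared frequency of small oscillations, source of the limit 2π/√(2λ). -/
lemma potentialD2_steady (hl : 1 < l) : potentialD2 l (steady l) = 2 * l := by
  rw [potentialD2, forceRatio_steady hl]; ring

lemma potentialD1_ne (hl : 1 < l) (h0 : 0 < x) (hx : x ≠ steady l) : potentialD1 l x ≠ 0 := by
  rcases hx.lt_or_gt with h | h
  · exact (potentialD1_neg hl h0 h).ne
  · exact (potentialD1_pos hl h).ne'

lemma strictMonoOn_potential (hl : 1 < l) : StrictMonoOn (potential l) (Ici (steady l)) := by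
  refine strictMonoOn_of_deriv_pos (convex_Ici _) (continuous_potential hl).continuousOn ?_
  intro x hx
  rw [interior_Ici, mem_Ioi] at hx
  rw [(hasDerivAt_potential hl ((steady_pos hl).trans hx)).deriv]
  exact potentialD1_pos hl hx

lemma strictAntiOn_potential (hl : 1 < l) :
    StrictAntiOn (potential l) (Icc 0 (steady l)) := by
  refine strictAntiOn_of_deriv_neg (convex_Icc _ _) (continuous_potential hl).continuousOn ?_
  intro x hx
  rw [interior_Icc] at hx
  rw [(hasDerivAt_potential hl hx.1).deriv]
  exact potentialD1_neg hl hx.1 hx.2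

lemma potential_pos (hl : 1 < l) (h0 : 0 ≤ x) (hx : x ≠ steady l) : 0 < potential l x := by
  rw [← potential_steady hl]
  rcases hx.lt_or_gt with h | h
  · exact strictAntiOn_potential hl ⟨h0, h.le⟩ ⟨(steady_pos hl).le, le_rfl⟩ h
  · exact strictMonoOn_potential hl (mem_Ici.2 le_rfl) (mem_Ici.2 h.le) h

lemma potential_nonneg (hl : 1 < l) (h0 : 0 ≤ x) : 0 ≤ potential l x := by
  by_cases h : x = steady l
  · rw [h, potential_steady hl]
  · exact (potential_pos hl h0 h).le

/-! ### Chicone's criterion: the sign of (V/V'²)'' -/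

/-- For `V = potential l`, the coefficient of `V` in `chiconeK l`, as a polynomial in
`forceRatio`. -/
def chiconeQ (l p : ℝ) : ℝ :=
  3 * l ^ 2 + (4 + 10 * l - 6 * l ^ 2) * p + (l - 2) * (3 * l - 4) * p ^ 2

/-- The function `chiconeK l` divided by its coefficient of the potential. -/
def chiconeM (l x : ℝ) : ℝ :=
  potential l x - 3 / 2 * l ^ 3 * x ^ 2 * (1 - forceRatio l x) ^ 2 *
    (l - (l - 2) * forceRatio l x) / chiconeQ l (forceRatio l x)

/-- The numerator of the second derivative of `potential l / potentialD1 l ^ 2`. -/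
def chiconeK (l x : ℝ) : ℝ :=
  6 * potential l x * potentialD2 l x ^ 2 - 3 * potentialD1 l x ^ 2 * potentialD2 l x
    - 2 * potential l x * potentialD1 l x * potentialD3 l x

lemma chiconeK_eq (hx : 0 < x) : chiconeK l x =
    2 * l ^ 2 * (potential l x * chiconeQ l (forceRatio l x) - 3 / 2 * l ^ 3 * x ^ 2 *
      (1 - forceRatio l x) ^ 2 * (l - (l - 2) * forceRatio l x)) := by
  rw [chiconeK, potentialD1, potentialD2, potentialD3, chiconeQ]
  field_simp
  ring

lemma chiconeK_eq_mul (hx : 0 < x) (hQ : chiconeQ l (forceRatio l x) ≠ 0) :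
    chiconeK l x = 2 * l ^ 2 * (chiconeQ l (forceRatio l x) * chiconeM l x) := by
  rw [chiconeK_eq hx, chiconeM]
  field_simp

lemma chiconeM_steady (hl : 1 < l) : chiconeM l (steady l) = 0 := by
  rw [chiconeM, forceRatio_steady hl, potential_steady hl]; ring

/-- This is the reason for dividing by `chiconeQ`: V then enters with coefficient 1 and
differentiates to λ²x(1 - p), so V itself disappears. The result factors: (1 - p)³ changes sign at
the steady state and λ - 2 fixes the direction. -/
lemma hasDerivAt_chiconeM (hl : 1 < l) (hx : 0 < x) (hQ : chiconeQ l (forceRatio l x) ≠ 0) :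
    HasDerivAt (chiconeM l) (l ^ 2 * x * (1 - forceRatio l x) ^ 3 * forceRatio l x * (l - 2) *
      (3 * l * (l + 2) - (l - 2) * (3 * l - 4) * forceRatio l x) /
        chiconeQ l (forceRatio l x) ^ 2) x := by
  have hp := hasDerivAt_forceRatio (l := l) hx
  have hQd : HasDerivAt (fun x => chiconeQ l (forceRatio l x))
      ((4 + 10 * l - 6 * l ^ 2) * (-2 / l * forceRatio l x / x) + (l - 2) * (3 * l - 4) *
        (2 * forceRatio l x * (-2 / l * forceRatio l x / x))) x := by
    have := ((hp.const_mul (4 + 10 * l - 6 * l ^ 2)).const_add (3 * l ^ 2)).add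
      ((hp.pow 2).const_mul ((l - 2) * (3 * l - 4)))
    exact this.congr_deriv (by push_cast; ring)
  have hN := ((((hasDerivAt_pow 2 x).const_mul (3 / 2 * l ^ 3)).mul ((hp.const_sub 1).pow 2)).mul
    ((hp.const_mul (l - 2)).const_sub l)).div hQd hQ
  refine ((hasDerivAt_potential hl hx).sub hN).congr_deriv ?_
  rw [potentialD1]
  simp only [Pi.mul_apply, Pi.pow_apply]
  generalize hq : chiconeQ l (forceRatio l x) = q at *
  generalize forceRatio l x = p at *
  field_simp
  rw [← hq, chiconeQ]
  push_cast
  ring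

/-- Completing the square in p: the discriminant of the quadratic is -4(λ-2)(11λ+2), negative for λ
> 2. -/
lemma chiconeQ_pos (hl : 2 < l) (p : ℝ) : 0 < chiconeQ l p := by
  have h : 12 * l ^ 2 * chiconeQ l p = (6 * l ^ 2 + (4 + 10 * l - 6 * l ^ 2) * p) ^ 2
      + 4 * (l - 2) * (11 * l + 2) * p ^ 2 := by rw [chiconeQ]; ring
  have h2 : 0 < 12 * l ^ 2 * chiconeQ l p := by
    rw [h]
    have : 0 < 4 * (l - 2) * (11 * l + 2) := by nlinarith
    by_cases hp : p = 0
    · subst hp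
      simp only [mul_zero, add_zero, ne_eq, OfNat.ofNat_ne_zero, not_false_eq_true, zero_pow]
      positivity
    · exact add_pos_of_nonneg_of_pos (sq_nonneg _) (mul_pos this (by positivity))
  exact pos_of_mul_pos_right h2 (by positivity)

/-- `chiconeQ l` is concave for `4/3 ≤ λ ≤ 2`, and positive at `0`. -/
lemma chiconeQ_pos_of_le (hl : 4 / 3 ≤ l) (hl2 : l ≤ 2) {p p₀ : ℝ} (hp : 0 ≤ p)
    (hpp : p ≤ p₀) (h1 : 1 ≤ p₀) (hQ : 0 < chiconeQ l p₀) : 0 < chiconeQ l p := by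
  have hc : (l - 2) * (3 * l - 4) ≤ 0 :=
    mul_nonpos_of_nonpos_of_nonneg (by linarith) (by linarith)
  -- Concavity on [0, p₀] cleared of denominators: the chord through the values 3λ² at 0 and
  -- `chiconeQ l p₀` at p₀, plus a nonnegative remainder.
  have key : p₀ * chiconeQ l p = (p₀ - p) * (3 * l ^ 2) + p * chiconeQ l p₀
      + (-((l - 2) * (3 * l - 4))) * (p * p₀ * (p₀ - p)) := by
    simp only [chiconeQ]; ring
  have h3 : 0 < p₀ * chiconeQ l p := by
    rw [key]
    have a1 : 0 ≤ (p₀ - p) * (3 * l ^ 2) := mul_nonneg (by linarith) (by positivity)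
    have a2 : 0 ≤ p * chiconeQ l p₀ := mul_nonneg hp hQ.le
    have a3 : 0 ≤ (-((l - 2) * (3 * l - 4))) * (p * p₀ * (p₀ - p)) :=
      mul_nonneg (by linarith) (mul_nonneg (mul_nonneg hp (by linarith)) (by linarith))
    rcases hp.eq_or_lt with h | h
    · subst h
      have : 0 < (p₀ - 0) * (3 * l ^ 2) := mul_pos (by linarith) (by positivity)
      linarith
    · have : 0 < p * chiconeQ l p₀ := mul_pos h hQ
      linarith
  exact pos_of_mul_pos_right h3 (by linarith)

/-- Chicone's convexity criterion for `λ > 2`. -/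
lemma chiconeK_pos (hl : 2 < l) (h0 : 0 < x) (hx : x ≠ steady l) : 0 < chiconeK l x := by
  have hl1 : 1 < l := by linarith
  have hs := steady_pos hl1
  have hQ : ∀ y, 0 < chiconeQ l (forceRatio l y) := fun y => chiconeQ_pos hl _
  rw [chiconeK_eq_mul h0 (hQ x).ne']
  refine mul_pos (by positivity) (mul_pos (hQ x) ?_)
  have hcont : ∀ s ⊆ Ioi (0:ℝ), ContinuousOn (chiconeM l) s := fun s hs y hy =>
    (hasDerivAt_chiconeM hl1 (hs hy) (hQ y).ne').continuousAt.continuousWithinAt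
  -- Multiplying (λ-2)p < λ by 3λ-4 > 0 bounds the subtracted term by λ(3λ-4), which is less than
  -- 3λ(λ+2).
  have hb : ∀ p, p * (l - 2) < l → 0 < 3 * l * (l + 2) - (l - 2) * (3 * l - 4) * p := by
    intro p hp
    nlinarith [mul_lt_mul_of_pos_right hp (show 0 < 3 * l - 4 by linarith)]
  rw [← chiconeM_steady hl1]
  rcases hx.lt_or_gt with h | h
  -- To the left of the steady state p > 1 can be large. The bound (λ-2)p < λ says V'' > 0; if it
  -- holds at x it persists up to the steady state, because p decreases.
  · by_cases hp : forceRatio l x * (l - 2) < l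
    · refine strictAntiOn_of_deriv_neg (convex_Icc x (steady l))
        (hcont _ fun y hy => h0.trans_le hy.1) ?_ ⟨le_rfl, h.le⟩ ⟨h.le, le_rfl⟩ h
      intro y hy
      rw [interior_Icc] at hy
      have hy0 : 0 < y := h0.trans hy.1
      rw [(hasDerivAt_chiconeM hl1 hy0 (hQ y).ne').deriv]
      have h1 := forceRatio_lt hl1 hy0 hy.2
      rw [forceRatio_steady hl1] at h1
      have h2 := forceRatio_lt hl1 h0 hy.1
      have h3 : 0 < 3 * l * (l + 2) - (l - 2) * (3 * l - 4) * forceRatio l y :=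
        hb _ (by nlinarith)
      have h4 : (1 - forceRatio l y) ^ 3 < 0 := Odd.pow_neg (by decide) (by linarith)
      refine div_neg_of_neg_of_pos ?_ (pow_pos (hQ y) 2)
      refine mul_neg_of_neg_of_pos ?_ h3
      refine mul_neg_of_neg_of_pos ?_ (by linarith)
      refine mul_neg_of_neg_of_pos ?_ (by linarith)
      exact mul_neg_of_pos_of_neg (by positivity) h4
    -- Here V'' ≤ 0, so the term subtracted in `chiconeM` is nonpositive and V > 0 suffices.
    · rw [chiconeM_steady hl1, chiconeM]
      have h1 : 3 / 2 * l ^ 3 * x ^ 2 * (1 - forceRatio l x) ^ 2 *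
          (l - (l - 2) * forceRatio l x) / chiconeQ l (forceRatio l x) ≤ 0 :=
        div_nonpos_of_nonpos_of_nonneg
          (mul_nonpos_of_nonneg_of_nonpos (by positivity) (by linarith)) (hQ x).le
      linarith [potential_pos hl1 h0.le hx]
  · refine strictMonoOn_of_deriv_pos (convex_Icc (steady l) x)
      (hcont _ fun y hy => hs.trans_le hy.1) ?_ ⟨le_rfl, h.le⟩ ⟨h.le, le_rfl⟩ h
    intro y hy
    rw [interior_Icc] at hy
    have hy0 : 0 < y := hs.trans hy.1
    rw [(hasDerivAt_chiconeM hl1 hy0 (hQ y).ne').deriv]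
    have h1 := forceRatio_lt hl1 hs hy.1
    rw [forceRatio_steady hl1] at h1
    have hp := forceRatio_pos hl1 hy0
    have h3 : 0 < 3 * l * (l + 2) - (l - 2) * (3 * l - 4) * forceRatio l y :=
      hb _ (by nlinarith)
    have h4 : 0 < (1 - forceRatio l y) ^ 3 := pow_pos (by linarith) 3
    have h5 : 0 < l - 2 := by linarith
    have := hQ y
    positivity

/-- Chicone's criterion with reversed sign for `4/3 ≤ λ < 2`. -/
lemma chiconeK_neg (hl : 4 / 3 ≤ l) (hl2 : l < 2) (h0 : 0 < x) (hx : x ≠ steady l) :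
    chiconeK l x < 0 := by
  have hl1 : 1 < l := by linarith
  have hs := steady_pos hl1
  have hb : ∀ p, 0 < p → 0 < 3 * l * (l + 2) - (l - 2) * (3 * l - 4) * p := by
    intro p hp
    have : (l - 2) * (3 * l - 4) * p ≤ 0 := mul_nonpos_of_nonpos_of_nonneg
      (mul_nonpos_of_nonpos_of_nonneg (by linarith) (by linarith)) hp.le
    nlinarith
  have hQ1 : 0 < chiconeQ l 1 := by
    have : chiconeQ l 1 = 12 := by rw [chiconeQ]; ring
    rw [this]; norm_num
  have hpx := forceRatio_pos hl1 h0
  rcases hx.lt_or_gt with h | h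
  · have h1x := forceRatio_lt hl1 h0 h
    rw [forceRatio_steady hl1] at h1x
    -- If Q is positive at x, concavity keeps it positive up to the steady state and the
    -- monotonicity of `chiconeM` applies. If not, both terms of `chiconeK_eq` already have the
    -- right sign.
    by_cases hQx : 0 < chiconeQ l (forceRatio l x)
    · have hQ : ∀ y, x ≤ y → 0 < chiconeQ l (forceRatio l y) := by
        intro y hy
        have : forceRatio l y ≤ forceRatio l x := by
          rcases hy.eq_or_lt with h | h
          · rw [h]
          · exact (forceRatio_lt hl1 h0 h).le
        exact chiconeQ_pos_of_le hl hl2.le (forceRatio_pos hl1 (h0.trans_le hy)).le this h1x.le hQx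
      rw [chiconeK_eq_mul h0 hQx.ne']
      refine mul_neg_of_pos_of_neg (by positivity) (mul_neg_of_pos_of_neg hQx ?_)
      rw [← chiconeM_steady hl1]
      refine strictMonoOn_of_deriv_pos (convex_Icc x (steady l)) (fun y hy =>
        (hasDerivAt_chiconeM hl1 (h0.trans_le hy.1)
          (hQ y hy.1).ne').continuousAt.continuousWithinAt)
        ?_ ⟨le_rfl, h.le⟩ ⟨h.le, le_rfl⟩ h
      intro y hy
      rw [interior_Icc] at hy
      have hy0 : 0 < y := h0.trans hy.1
      rw [(hasDerivAt_chiconeM hl1 hy0 (hQ y hy.1.le).ne').deriv]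
      have h1 := forceRatio_lt hl1 hy0 hy.2
      rw [forceRatio_steady hl1] at h1
      have h4 : (1 - forceRatio l y) ^ 3 < 0 := Odd.pow_neg (by decide) (by linarith)
      refine div_pos ?_ (pow_pos (hQ y hy.1.le) 2)
      refine mul_pos ?_ (hb _ (by linarith))
      refine mul_pos_of_neg_of_neg ?_ (by linarith)
      refine mul_neg_of_neg_of_pos ?_ (by linarith)
      exact mul_neg_of_pos_of_neg (by positivity) h4
    · rw [chiconeK_eq h0]
      refine mul_neg_of_pos_of_neg (by positivity) ?_
      have h1 : potential l x * chiconeQ l (forceRatio l x) ≤ 0 :=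
        mul_nonpos_of_nonneg_of_nonpos (potential_nonneg hl1 h0.le) (by linarith)
      have h2 : 0 < 3 / 2 * l ^ 3 * x ^ 2 * (1 - forceRatio l x) ^ 2 *
          (l - (l - 2) * forceRatio l x) := by
        have a1 : 0 < (1 - forceRatio l x) ^ 2 := by
          have : 1 - forceRatio l x ≠ 0 := by linarith
          positivity
        have a2 : 0 < l - (l - 2) * forceRatio l x := by nlinarith
        positivity
      linarith
  · have hQ : ∀ y, steady l ≤ y → 0 < chiconeQ l (forceRatio l y) := by
      intro y hy
      have : forceRatio l y ≤ 1 := by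
        rw [← forceRatio_steady hl1]
        rcases hy.eq_or_lt with h | h
        · rw [h]
        · exact (forceRatio_lt hl1 hs h).le
      exact chiconeQ_pos_of_le hl hl2.le (forceRatio_pos hl1 (hs.trans_le hy)).le this le_rfl hQ1
    rw [chiconeK_eq_mul h0 (hQ x h.le).ne']
    refine mul_neg_of_pos_of_neg (by positivity) (mul_neg_of_pos_of_neg (hQ x h.le) ?_)
    rw [← chiconeM_steady hl1]
    refine strictAntiOn_of_deriv_neg (convex_Icc (steady l) x) (fun y hy =>
      (hasDerivAt_chiconeM hl1 (hs.trans_le hy.1) (hQ y hy.1).ne').continuousAt.continuousWithinAt)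
      ?_ ⟨le_rfl, h.le⟩ ⟨h.le, le_rfl⟩ h
    intro y hy
    rw [interior_Icc] at hy
    have hy0 : 0 < y := hs.trans hy.1
    rw [(hasDerivAt_chiconeM hl1 hy0 (hQ y hy.1.le).ne').deriv]
    have h1 := forceRatio_lt hl1 hs hy.1
    rw [forceRatio_steady hl1] at h1
    have hp := forceRatio_pos hl1 hy0
    refine div_neg_of_neg_of_pos ?_ (pow_pos (hQ y hy.1.le) 2)
    refine mul_neg_of_neg_of_pos ?_ (hb _ hp)
    refine mul_neg_of_pos_of_neg ?_ (by linarith)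
    have h4 : 0 < (1 - forceRatio l y) ^ 3 := pow_pos (by linarith) 3
    positivity

/-- The derivative of `potential l / potentialD1 l ^ 2`. -/
def chiconeN (l x : ℝ) : ℝ :=
  1 / potentialD1 l x - 2 * potential l x * potentialD2 l x / potentialD1 l x ^ 3

lemma hasDerivAt_chiconeN (hl : 1 < l) (h0 : 0 < x) (hx : x ≠ steady l) :
    HasDerivAt (chiconeN l) (chiconeK l x / potentialD1 l x ^ 4) x := by
  have hne := potentialD1_ne hl h0 hx
  have h1 := hasDerivAt_potentialD1 hl h0
  have := ((hasDerivAt_const x (1:ℝ)).div h1 hne).sub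
    ((((hasDerivAt_potential hl h0).const_mul 2).mul (hasDerivAt_potentialD2 hl h0)).div
      (h1.pow 3) (pow_ne_zero 3 hne))
  refine this.congr_deriv ?_
  rw [chiconeK]
  simp only [Pi.mul_apply, Pi.pow_apply]
  field_simp
  push_cast
  ring

lemma hasDerivAt_potential_div (hl : 1 < l) (h0 : 0 < x) (hx : x ≠ steady l) :
    HasDerivAt (fun x => 2 * potential l x / potentialD1 l x ^ 2) (2 * chiconeN l x) x := by
  have hne := potentialD1_ne hl h0 hx
  have h1 := hasDerivAt_potentialD1 hl h0
  have := ((hasDerivAt_potential hl h0).const_mul 2).div (h1.pow 2) (pow_ne_zero 2 hne)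
  refine this.congr_deriv ?_
  rw [chiconeN]
  simp only [Pi.pow_apply]
  field_simp
  push_cast
  ring

lemma eventually_pos_ne (hl : 1 < l) : ∀ᶠ x in 𝓝[≠] (steady l), 0 < x ∧ x ≠ steady l := by
  filter_upwards [self_mem_nhdsWithin, nhdsWithin_le_nhds (lt_mem_nhds (steady_pos hl))]
    with x hx h0 using ⟨h0, hx⟩

/-- One application of L'Hôpital's rule at the nondegenerate minimum gives 2V/V'² → 1/V''. -/
lemma tendsto_potential_div (hl : 1 < l) :
    Tendsto (fun x => 2 * potential l x / potentialD1 l x ^ 2) (𝓝[≠] (steady l))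
      (𝓝 (1 / (2 * l))) := by
  have hs := steady_pos hl
  have hc := (hasDerivAt_potential hl hs).continuousAt
  have hc1 := (hasDerivAt_potentialD1 hl hs).continuousAt
  have hc2 := (hasDerivAt_potentialD2 hl hs).continuousAt
  have hne : ∀ᶠ x in 𝓝[≠] (steady l), potentialD2 l x ≠ 0 := by
    refine nhdsWithin_le_nhds (hc2.eventually_ne ?_)
    rw [potentialD2_steady hl]; positivity
  refine HasDerivAt.lhopital_zero_nhdsNE
    (f' := fun x => 2 * potentialD1 l x) (g' := fun x => 2 * potentialD1 l x * potentialD2 l x)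
    ?_ ?_ ?_ ?_ ?_ ?_
  · filter_upwards [eventually_pos_ne hl] with x hx
    exact (hasDerivAt_potential hl hx.1).const_mul 2
  · filter_upwards [eventually_pos_ne hl] with x hx
    exact ((hasDerivAt_potentialD1 hl hx.1).pow 2).congr_deriv (by push_cast; ring)
  · filter_upwards [eventually_pos_ne hl, hne] with x hx h2
    exact mul_ne_zero (mul_ne_zero two_ne_zero (potentialD1_ne hl hx.1 hx.2)) h2
  · have := (hc.const_mul 2).tendsto
    rw [potential_steady hl, mul_zero] at this
    exact this.mono_left nhdsWithin_le_nhds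
  · have := (hc1.pow 2).tendsto
    rw [Pi.pow_apply, potentialD1_steady hl, zero_pow two_ne_zero] at this
    exact this.mono_left nhdsWithin_le_nhds
  · have h := (hc2.tendsto.inv₀ (by rw [potentialD2_steady hl]; positivity)).mono_left
      (nhdsWithin_le_nhds (s := {steady l}ᶜ))
    rw [potentialD2_steady hl, ← one_div] at h
    refine h.congr' ?_
    filter_upwards [eventually_pos_ne hl, hne] with x hx h2
    have := potentialD1_ne hl hx.1 hx.2
    field_simp

/-- Write N = (V'² - 2VV'')/V'³. L'Hôpital's rule leaves -(1/3)(2V/V'²)(V'''/V''), which has a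
finite limit. Its value is immaterial: it only serves to join the two sides of the steady state. -/
lemma exists_tendsto_chiconeN (hl : 1 < l) :
    ∃ c, Tendsto (chiconeN l) (𝓝[≠] (steady l)) (𝓝 c) := by
  have hs := steady_pos hl
  have hc := (hasDerivAt_potential hl hs).continuousAt
  have hc1 := (hasDerivAt_potentialD1 hl hs).continuousAt
  have hc2 := (hasDerivAt_potentialD2 hl hs).continuousAt
  have hc3 : ContinuousAt (potentialD3 l) (steady l) := by
    unfold potentialD3
    have := (hasDerivAt_forceRatio (l := l) hs).continuousAt
    exact (continuousAt_const.mul this).div continuousAt_id hs.ne'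
  have hs2 : potentialD2 l (steady l) ≠ 0 := by rw [potentialD2_steady hl]; positivity
  have hne : ∀ᶠ x in 𝓝[≠] (steady l), potentialD2 l x ≠ 0 :=
    nhdsWithin_le_nhds (hc2.eventually_ne hs2)
  have h3 := (hc3.div hc2 hs2).tendsto.mono_left
      (nhdsWithin_le_nhds (s := {steady l}ᶜ))
  have hlim := ((tendsto_potential_div hl).mul h3).const_mul (-1 / 3)
  refine ⟨_, Tendsto.congr' (f₁ := fun x => (potentialD1 l x ^ 2 - 2 * potential l x *
    potentialD2 l x) / potentialD1 l x ^ 3) ?_ (HasDerivAt.lhopital_zero_nhdsNE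
    (f' := fun x => - 2 * potential l x * potentialD3 l x)
    (g' := fun x => 3 * potentialD1 l x ^ 2 * potentialD2 l x)
    ?_ ?_ ?_ ?_ ?_ (hlim.congr' ?_))⟩
  · filter_upwards [eventually_pos_ne hl] with x hx
    have := potentialD1_ne hl hx.1 hx.2
    rw [chiconeN]
    field_simp
  · filter_upwards [eventually_pos_ne hl] with x hx
    have := ((hasDerivAt_potentialD1 hl hx.1).pow 2).sub
      (((hasDerivAt_potential hl hx.1).const_mul 2).mul (hasDerivAt_potentialD2 hl hx.1))
    exact this.congr_deriv (by push_cast; ring)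
  · filter_upwards [eventually_pos_ne hl] with x hx
    exact ((hasDerivAt_potentialD1 hl hx.1).pow 3).congr_deriv (by push_cast; ring)
  · filter_upwards [eventually_pos_ne hl, hne] with x hx h2
    exact mul_ne_zero (mul_ne_zero three_ne_zero (pow_ne_zero _ (potentialD1_ne hl hx.1 hx.2))) h2
  · have := ((hc1.pow 2).sub ((hc.const_mul 2).mul hc2)).tendsto
    simp only [Pi.pow_apply, Pi.mul_apply, Pi.sub_apply, potential_steady hl,
      potentialD1_steady hl] at this
    norm_num at this
    exact this.mono_left nhdsWithin_le_nhds
  · have := (hc1.pow 3).tendsto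
    rw [Pi.pow_apply, potentialD1_steady hl, zero_pow three_ne_zero] at this
    exact this.mono_left nhdsWithin_le_nhds
  · filter_upwards [eventually_pos_ne hl, hne] with x hx h2
    have := potentialD1_ne hl hx.1 hx.2
    simp only [Pi.div_apply]
    field_simp

/-- `f` increases on each side of `a`, and the common limit `c` lies between the two branches. This
covers N, whose formula degenerates at the steady state. -/
lemma lt_of_deriv_pos_of_tendsto {f f' : ℝ → ℝ} {a c : ℝ}
    (hd : ∀ x, 0 < x → x ≠ a → HasDerivAt f (f' x) x)
    (hp : ∀ x, 0 < x → x ≠ a → 0 < f' x) (hc : Tendsto f (𝓝[≠] a) (𝓝 c)) {x y : ℝ}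
    (h0 : 0 < x) (hx : x < a) (hy : a < y) : f x < f y := by
  have hmono1 : StrictMonoOn f (Ioo 0 a) := by
    refine strictMonoOn_of_deriv_pos (convex_Ioo _ _) (fun z hz =>
      (hd z hz.1 hz.2.ne).continuousAt.continuousWithinAt) fun z hz => ?_
    rw [interior_Ioo] at hz
    rw [(hd z hz.1 hz.2.ne).deriv]
    exact hp z hz.1 hz.2.ne
  have ha : 0 < a := h0.trans hx
  have hmono2 : StrictMonoOn f (Ioi a) := by
    refine strictMonoOn_of_deriv_pos (convex_Ioi _) (fun z hz =>
      (hd z (ha.trans hz) (ne_of_gt hz)).continuousAt.continuousWithinAt) fun z hz => ?_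
    rw [interior_Ioi] at hz
    rw [(hd z (ha.trans hz) (ne_of_gt hz)).deriv]
    exact hp z (ha.trans hz) (ne_of_gt hz)
  obtain ⟨u, hxu, hua⟩ := exists_between hx
  obtain ⟨w, haw, hwy⟩ := exists_between hy
  have h1 : f x < f u := hmono1 ⟨h0, hx⟩ ⟨h0.trans hxu, hua⟩ hxu
  have h2 : f w < f y := hmono2 haw hy hwy
  have h3 : f u ≤ c := by
    refine ge_of_tendsto (hc.mono_left (nhdsWithin_mono a
      (show Iio a ⊆ {a}ᶜ from fun z hz => ne_of_lt hz))) ?_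
    filter_upwards [Ioo_mem_nhdsLT hua] with z hz
    exact (hmono1 ⟨h0.trans hxu, hua⟩ ⟨(h0.trans hxu).trans hz.1, hz.2⟩ hz.1).le
  have h4 : c ≤ f w := by
    refine le_of_tendsto (hc.mono_left (nhdsWithin_mono a
      (show Ioi a ⊆ {a}ᶜ from fun z hz => ne_of_gt hz))) ?_
    filter_upwards [Ioo_mem_nhdsGT haw] with z hz
    exact (hmono2 hz.1 haw hz.2).le
  linarith

lemma chiconeN_lt (hl : 2 < l) {y : ℝ} (h0 : 0 < x) (hx : x < steady l) (hy : steady l < y) :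
    chiconeN l x < chiconeN l y := by
  have hl1 : 1 < l := by linarith
  obtain ⟨c, hc⟩ := exists_tendsto_chiconeN hl1
  refine lt_of_deriv_pos_of_tendsto (fun x => hasDerivAt_chiconeN hl1) (fun x h1 h2 => ?_) hc
    h0 hx hy
  have := potentialD1_ne hl1 h1 h2
  have := chiconeK_pos hl h1 h2
  positivity

lemma chiconeN_gt (hl : 4 / 3 ≤ l) (hl2 : l < 2) {y : ℝ} (h0 : 0 < x) (hx : x < steady l)
    (hy : steady l < y) : chiconeN l y < chiconeN l x := by
  have hl1 : 1 < l := by linarith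
  obtain ⟨c, hc⟩ := exists_tendsto_chiconeN hl1
  refine neg_lt_neg_iff.1 (lt_of_deriv_pos_of_tendsto
    (fun x h1 h2 => (hasDerivAt_chiconeN hl1 h1 h2).neg) (fun x h1 h2 => ?_) hc.neg h0 hx hy)
  have := potentialD1_ne hl1 h1 h2
  rw [← neg_div]
  exact div_pos (neg_pos.2 (chiconeK_neg hl hl2 h1 h2)) (by positivity)

end

/-! ### The square-root coordinate and the period integral of elliptic orbits -/

section


/-- The signed square root of twice the potential energy. -/
def coord (l x : ℝ) : ℝ :=
  √(2 * potential l (max x (steady l))) - √(2 * potential l (min x (steady l)))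

/-- The derivative of `coord`. -/
def speed (l x : ℝ) : ℝ :=
  if x = steady l then √(2 * l) else √(potentialD1 l x ^ 2 / (2 * potential l x))

variable {l x : ℝ}

lemma coord_of_le (hl : 1 < l) (hx : x ≤ steady l) : coord l x = -√(2 * potential l x) := by
  rw [coord, max_eq_right hx, min_eq_left hx, potential_steady hl]
  simp

lemma coord_of_ge (hl : 1 < l) (hx : steady l ≤ x) : coord l x = √(2 * potential l x) := by
  rw [coord, max_eq_left hx, min_eq_right hx, potential_steady hl]
  simp

lemma coord_steady (hl : 1 < l) : coord l (steady l) = 0 := by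
  rw [coord_of_le hl le_rfl, potential_steady hl]
  simp

lemma coord_zero (hl : 1 < l) : coord l 0 = -√(2 * pMax l) := by
  rw [coord_of_le hl (steady_pos hl).le, potential_zero hl]

lemma coord_sq (hl : 1 < l) (hx : 0 ≤ x) : coord l x ^ 2 = 2 * potential l x := by
  have := potential_nonneg hl hx
  rcases le_total x (steady l) with h | h
  · rw [coord_of_le hl h, neg_sq, Real.sq_sqrt (by positivity)]
  · rw [coord_of_ge hl h, Real.sq_sqrt (by positivity)]

lemma continuous_coord (hl : 1 < l) : Continuous (coord l) := by
  have := continuous_potential hl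
  unfold coord
  fun_prop

lemma strictMonoOn_coord (hl : 1 < l) : StrictMonoOn (coord l) (Ici 0) := by
  have hs := steady_pos hl
  have h1 : StrictMonoOn (coord l) (Icc 0 (steady l)) := by
    intro x hx y hy hxy
    rw [coord_of_le hl hx.2, coord_of_le hl hy.2]
    have := strictAntiOn_potential hl hx hy hxy
    exact neg_lt_neg (Real.sqrt_lt_sqrt (mul_nonneg zero_le_two (potential_nonneg hl hy.1))
      (by linarith))
  have h2 : StrictMonoOn (coord l) (Ici (steady l)) := by
    intro x hx y hy hxy
    rw [coord_of_ge hl hx, coord_of_ge hl hy]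
    have := strictMonoOn_potential hl hx hy hxy
    exact Real.sqrt_lt_sqrt (mul_nonneg zero_le_two (potential_nonneg hl (hs.le.trans hx)))
      (by linarith)
  have := h1.union h2 (isGreatest_Icc hs.le) isLeast_Ici
  rwa [Icc_union_Ici_eq_Ici hs.le] at this

lemma tendsto_potential_atTop (hl : 1 < l) : Tendsto (potential l) atTop atTop := by
  have hexp : 0 < 2 / l := by positivity
  have h1 : Tendsto (fun x : ℝ => x ^ (-2 / l)) atTop (𝓝 0) := by
    have := tendsto_rpow_neg_atTop hexp
    simpa [neg_div] using this
  have h2 : Tendsto (fun x => 1 - l / (l - 1) * forceRatio l x) atTop (𝓝 1) := by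
    have := ((h1.const_mul ((l - 1) / l ^ 3)).const_mul (l / (l - 1))).const_sub 1
    simpa [forceRatio] using this
  have h3 : Tendsto (fun x : ℝ => l ^ 2 / 2 * x ^ 2) atTop atTop :=
    (tendsto_pow_atTop two_ne_zero).const_mul_atTop (by positivity)
  have h4 := tendsto_atTop_add_const_right _ (pMax l) (h3.atTop_mul_pos one_pos h2)
  refine h4.congr' ?_
  filter_upwards [eventually_gt_atTop 0] with x hx
  rw [potential_eq hl hx]

lemma tendsto_coord_atTop (hl : 1 < l) : Tendsto (coord l) atTop atTop := by
  refine (Real.tendsto_sqrt_atTop.comp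
    ((tendsto_potential_atTop hl).const_mul_atTop two_pos)).congr' ?_
  filter_upwards [eventually_ge_atTop (steady l)] with x hx
  rw [coord_of_ge hl hx]
  rfl

lemma speed_of_ne (hx : x ≠ steady l) :
    speed l x = √(2 * potential l x / potentialD1 l x ^ 2)⁻¹ := by
  rw [speed, if_neg hx, inv_div]

lemma speed_pos (hl : 1 < l) (h0 : 0 < x) : 0 < speed l x := by
  by_cases hx : x = steady l
  · rw [speed, if_pos hx]; positivity
  · rw [speed, if_neg hx]
    have := potential_pos hl h0.le hx
    have := potentialD1_ne hl h0 hx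
    positivity

/-- This is H H' = V', half the derivative of H² = 2V. -/
lemma coord_mul_speed (hl : 1 < l) (h0 : 0 < x) : speed l x * coord l x = potentialD1 l x := by
  by_cases hx : x = steady l
  · rw [hx, coord_steady hl, potentialD1_steady hl, mul_zero]
  have hV := potential_pos hl h0.le hx
  have h1 := lt_or_gt_of_ne hx
  rw [speed, if_neg hx, Real.sqrt_div (sq_nonneg _), Real.sqrt_sq_eq_abs]
  have : √(2 * potential l x) ≠ 0 := by positivity
  rcases h1 with h | h
  · rw [coord_of_le hl h.le, abs_of_neg (potentialD1_neg hl h0 h)]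
    field_simp
  · rw [coord_of_ge hl h.le, abs_of_pos (potentialD1_pos hl h)]
    field_simp

lemma continuousAt_speed (hl : 1 < l) (h0 : 0 < x) : ContinuousAt (speed l) x := by
  by_cases hx : x = steady l
  · rw [hx]
    rw [continuousAt_iff_punctured_nhds]
    have h1 := ((tendsto_potential_div hl).inv₀ (by positivity)).sqrt
    rw [one_div, inv_inv] at h1
    rw [speed, if_pos rfl]
    refine h1.congr' ?_
    filter_upwards [self_mem_nhdsWithin] with y hy
    rw [speed_of_ne hy]
  · have hV := potential_pos hl h0.le hx
    have h1 : ContinuousAt (fun x => √(potentialD1 l x ^ 2 / (2 * potential l x))) x :=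
      (((hasDerivAt_potentialD1 hl h0).continuousAt.pow 2).div
        (continuousAt_const.mul (hasDerivAt_potential hl h0).continuousAt)
        (mul_pos two_pos hV).ne').sqrt
    refine h1.congr ?_
    filter_upwards [isOpen_ne.mem_nhds hx] with y hy
    rw [speed, if_neg hy]

/-- H² = 2V is smooth and H vanishes only at the steady state, where the candidate derivative is
continuous; so `hasDerivAt_of_sq` applies even though the square root is singular there. -/
lemma hasDerivAt_coord (hl : 1 < l) (h0 : 0 < x) : HasDerivAt (coord l) (speed l x) x := by
  have hne : ∀ᶠ y in 𝓝[≠] x, coord l y ≠ 0 := by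
    have hE : ∀ᶠ y in 𝓝[≠] x, 0 < y ∧ y ≠ steady l := by
      by_cases hx : x = steady l
      · rw [hx]; exact eventually_pos_ne hl
      · refine nhdsWithin_le_nhds ?_
        filter_upwards [lt_mem_nhds h0, isOpen_ne.mem_nhds hx] with y h1 h2 using ⟨h1, h2⟩
    filter_upwards [hE] with y hy h
    have := potentialD1_ne hl hy.1 hy.2
    rw [← coord_mul_speed hl hy.1, h, mul_zero] at this
    exact this rfl
  refine hasDerivAt_of_sq (Eventually.of_forall fun y => (continuous_coord hl).continuousAt) ?_ hne
    (continuousAt_speed hl h0)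
  filter_upwards [lt_mem_nhds h0] with y hy
  have h1 := ((hasDerivAt_potential hl hy).const_mul 2).congr_of_eventuallyEq
    (f₁ := fun y => coord l y ^ 2) (by
      filter_upwards [lt_mem_nhds hy] with z hz using coord_sq hl (le_of_lt hz))
  refine h1.congr_deriv ?_
  rw [← coord_mul_speed hl hy]
  ring

lemma exists_coordInv (hl : 1 < l) : ∃ R : ℝ → ℝ, Continuous R ∧ StrictMono R ∧
    (∀ x, 0 ≤ x → R (coord l x) = x) ∧
      (∀ p, coord l 0 ≤ p → 0 ≤ R p ∧ coord l (R p) = p) ∧ Tendsto R atTop atTop :=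
  exists_inverse_Ici (strictMonoOn_coord hl) (continuous_coord hl).continuousOn
    (tendsto_coord_atTop hl)

open Classical in
/-- The inverse of `coord`. -/
def coordInv (l : ℝ) : ℝ → ℝ := if hl : 1 < l then (exists_coordInv hl).choose else id

lemma coordInv_spec (hl : 1 < l) : Continuous (coordInv l) ∧ StrictMono (coordInv l) ∧
    (∀ x, 0 ≤ x → coordInv l (coord l x) = x) ∧
      (∀ p, coord l 0 ≤ p → 0 ≤ coordInv l p ∧ coord l (coordInv l p) = p) ∧
      Tendsto (coordInv l) atTop atTop := by
  rw [coordInv, dif_pos hl]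
  exact (exists_coordInv hl).choose_spec

lemma coordInv_coord (hl : 1 < l) (hx : 0 ≤ x) : coordInv l (coord l x) = x :=
  (coordInv_spec hl).2.2.1 x hx

lemma coord_coordInv (hl : 1 < l) {s : ℝ} (hs : -√(2 * pMax l) ≤ s) :
    coord l (coordInv l s) = s :=
  ((coordInv_spec hl).2.2.2.1 s (by rwa [coord_zero hl])).2

lemma coordInv_nonneg (hl : 1 < l) {s : ℝ} (hs : -√(2 * pMax l) ≤ s) :
    0 ≤ coordInv l s :=
  ((coordInv_spec hl).2.2.2.1 s (by rwa [coord_zero hl])).1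

lemma coordInv_neg_sqrt (hl : 1 < l) : coordInv l (-√(2 * pMax l)) = 0 := by
  rw [← coord_zero hl, coordInv_coord hl le_rfl]

lemma coordInv_zero (hl : 1 < l) : coordInv l 0 = steady l := by
  rw [← coord_steady hl, coordInv_coord hl (steady_pos hl).le]

lemma coordInv_pos (hl : 1 < l) {s : ℝ} (hs : -√(2 * pMax l) < s) : 0 < coordInv l s := by
  rw [← coordInv_neg_sqrt hl]
  exact (coordInv_spec hl).2.1 hs

/-- The derivative of `coordInv`. -/
def tempo (l s : ℝ) : ℝ := (speed l (coordInv l s))⁻¹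

lemma tempo_pos (hl : 1 < l) {s : ℝ} (hs : -√(2 * pMax l) < s) : 0 < tempo l s :=
  inv_pos.2 (speed_pos hl (coordInv_pos hl hs))

lemma continuousAt_tempo (hl : 1 < l) {s : ℝ} (hs : -√(2 * pMax l) < s) :
    ContinuousAt (tempo l) s :=
  ((continuousAt_speed hl (coordInv_pos hl hs)).comp (coordInv_spec hl).1.continuousAt).inv₀
    (speed_pos hl (coordInv_pos hl hs)).ne'

lemma hasDerivAt_coordInv (hl : 1 < l) {s : ℝ} (hs : -√(2 * pMax l) < s) :
    HasDerivAt (coordInv l) (tempo l s) s := by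
  refine (hasDerivAt_coord hl (coordInv_pos hl hs)).of_local_left_inverse
    (coordInv_spec hl).1.continuousAt (speed_pos hl (coordInv_pos hl hs)).ne' ?_
  filter_upwards [lt_mem_nhds hs] with t ht using coord_coordInv hl (le_of_lt ht)

lemma pressure_eq (y : ℝ) : pressure l 1 x y = pMax l - y ^ 2 / 2 - potential l x := by
  rw [pressure, potential]; ring

/-- The period of the elliptic orbit of energy `r ^ 2 / 2` above the steady state. -/
def ellipticPeriod (l r : ℝ) : ℝ := ∫ θ in (0:ℝ)..(2 * Real.pi), tempo l (r * Real.sin θ)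

lemma neg_lt_mul_sin {r h₀ : ℝ} (hr : 0 ≤ r) (hh : r < h₀) (θ : ℝ) : -h₀ < r * Real.sin θ := by
  nlinarith [Real.neg_one_le_sin θ]

/-- In the coordinates (H, y) the equations read H' = w y, y' = -w H with w = `speed l x`: a
rotation of the circle of radius r with angular speed 1/`tempo l H`. -/
lemma isPeriod_ellipticPeriod (hl : 1 < l) {P r : ℝ} (hr : 0 < r) (hrm : r < √(2 * pMax l))
    (hP : r ^ 2 = 2 * (pMax l - P)) : IsPeriod l P 1 (ellipticPeriod l r) := by
  set D : ℝ → ℝ := fun θ => tempo l (r * Real.sin θ) with hDdef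
  -- The radius bound means P > 0: the circle stays above `coord l 0`, so the orbit never reaches x
  -- = 0.
  have hlow : ∀ θ, -√(2 * pMax l) < r * Real.sin θ := neg_lt_mul_sin hr.le hrm
  have hD : Continuous D := continuous_iff_continuousAt.2 fun θ =>
    ContinuousAt.comp (f := fun θ => r * Real.sin θ) (continuousAt_tempo hl (hlow θ))
      (by fun_prop)
  have hpos : ∀ θ, 0 < D θ := fun θ => tempo_pos hl (hlow θ)
  have hper : Function.Periodic D (2 * Real.pi) := fun θ => by
    simp only [hDdef, Real.sin_add_two_pi]
  obtain ⟨A, hA1, hA2, hA3, hA4, hA5⟩ := exists_angle hD hpos hper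
  have hA0 : A 0 = 0 := by simpa using hA3 0
  have hAT : A (ellipticPeriod l r) = 2 * Real.pi := hA3 _
  have hAper : ∀ t, A (t + ellipticPeriod l r) = A t + 2 * Real.pi :=
    angle_add_period hD hA3 hA4 hper
  constructor
  · refine ⟨fun t => coordInv l (r * Real.sin (A t)), fun t => r * Real.cos (A t),
      ⟨fun t _ => coordInv_pos hl (hlow _), fun t _ => ?_, fun t _ => ?_⟩, fun t => ?_⟩
    · have h1 := (hasDerivAt_coordInv hl (hlow (A t))).comp t ((hA5 t).sin.const_mul r)
      refine h1.congr_deriv ?_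
      have := (hpos (A t)).ne'
      simp only [hDdef] at this ⊢
      field_simp
    · rw [force_eq hl (coordInv_pos hl (hlow _)), ← coord_mul_speed hl (coordInv_pos hl (hlow _)),
        coord_coordInv hl (hlow _).le]
      refine ((hA5 t).cos.const_mul r).congr_deriv ?_
      simp only [hDdef, tempo, inv_inv]
      ring
    · rw [pressure_eq]
      have h1 := coord_sq hl (coordInv_nonneg hl (hlow (A t)).le)
      rw [coord_coordInv hl (hlow _).le] at h1
      have h2 := Real.sin_sq_add_cos_sq (A t)
      linear_combination (1 / 2) * h1 - r ^ 2 / 2 * h2 - (1 / 2) * hP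
  · rintro x y ⟨⟨hx, hdx, hdy⟩, hpr⟩
    have hx' : ∀ t, 0 < x t := fun t => hx t (mem_univ t)
    have hcx : ∀ t, ContinuousAt x t := fun t => (hdx t (mem_univ t)).continuousAt
    obtain ⟨c, hc⟩ := exists_shift (H := fun t => coord l (x t)) (z := y)
      (w := fun t => speed l (x t)) isOpen_univ ordConnected_univ (mem_univ 0) hr
      (fun t _ => ((continuousAt_speed hl (hx' t)).comp (hcx t)).continuousWithinAt)
      (fun t _ => (hasDerivAt_coord hl (hx' t)).comp t (hdx t (mem_univ t)))
      (fun t _ => by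
        rw [coord_mul_speed hl (hx' t), ← force_eq hl (hx' t)]
        exact hdy t (mem_univ t))
      (by
        have := hpr 0
        rw [pressure_eq] at this
        rw [coord_sq hl (hx' 0).le]
        linarith) hD hA3
      (fun t _ θ hθ => by
        simp only [hDdef, ← hθ, tempo]
        rw [coordInv_coord hl (hx' t).le, inv_mul_cancel₀ (speed_pos hl (hx' t)).ne'])
    have hc1 : ∀ t, x t = coordInv l (r * Real.sin (A (t + c))) := fun t => by
      rw [← (hc t (mem_univ t)).1, coordInv_coord hl (hx' t).le]
    have hc2 : ∀ t, y t = r * Real.cos (A (t + c)) := fun t => (hc t (mem_univ t)).2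
    refine ⟨⟨?_, fun t => ?_, fun t => ?_⟩, ?_⟩
    · rw [← hA2.lt_iff_lt, hA0, hAT]; positivity
    · rw [hc1, hc1, add_right_comm, hAper, Real.sin_add_two_pi]
    · rw [hc2, hc2, add_right_comm, hAper, Real.cos_add_two_pi]
    · rintro τ ⟨hτ, -, hy⟩
      -- At time -c the angle is 0 and y attains its maximum r, so a period must bring the angle to
      -- a multiple of 2π.
      have h1 := hy (-c)
      rw [hc2, hc2, neg_add_cancel, hA0, Real.cos_zero, neg_add_eq_sub, sub_add_cancel] at h1
      have h2 : Real.cos (A τ) = 1 := mul_left_cancel₀ hr.ne' h1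
      obtain ⟨n, hn⟩ := (Real.cos_eq_one_iff _).1 h2
      have h3 : 0 < A τ := by rw [← hA0]; exact hA2 hτ
      rw [← hA2.le_iff_le, hAT, ← hn]
      rw [← hn] at h3
      have h4 : (0:ℝ) < n := pos_of_mul_pos_left h3 (by positivity)
      have h5 : (1:ℝ) ≤ n := by exact_mod_cast (Int.cast_pos.1 h4 : 0 < n)
      nlinarith [Real.pi_pos]

end

/-! ### Monotonicity and limits of the elliptic period -/

section


lemma integral_comp_sin_pi {φ : ℝ → ℝ} (h : Continuous fun θ => φ (Real.sin θ)) :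
    ∫ θ in (0:ℝ)..Real.pi, φ (Real.sin θ) = 2 * ∫ θ in (0:ℝ)..(Real.pi / 2), φ (Real.sin θ) := by
  have h1 := intervalIntegral.integral_add_adjacent_intervals
    (h.intervalIntegrable (μ := MeasureTheory.volume) 0 (Real.pi / 2))
    (h.intervalIntegrable (Real.pi / 2) Real.pi)
  have h2 := intervalIntegral.integral_comp_sub_left (a := Real.pi / 2) (b := Real.pi)
    (fun θ => φ (Real.sin θ)) Real.pi
  simp only [Real.sin_pi_sub, sub_self] at h2
  rw [show Real.pi - Real.pi / 2 = Real.pi / 2 by ring] at h2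
  rw [← h1, h2]
  ring

lemma integral_comp_sin_two_pi {φ : ℝ → ℝ} (h : Continuous fun θ => φ (Real.sin θ)) :
    ∫ θ in (0:ℝ)..(2 * Real.pi), φ (Real.sin θ) =
      2 * ∫ θ in (0:ℝ)..(Real.pi / 2), (φ (Real.sin θ) + φ (-Real.sin θ)) := by
  have hm : Continuous fun θ => φ (-Real.sin θ) := by
    have := h.comp (continuous_neg (G := ℝ))
    simpa [Function.comp_def] using this
  have h1 := intervalIntegral.integral_add_adjacent_intervals
    (h.intervalIntegrable (μ := MeasureTheory.volume) 0 Real.pi)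
    (h.intervalIntegrable Real.pi (2 * Real.pi))
  have h2 := intervalIntegral.integral_comp_add_right (a := 0) (b := Real.pi)
    (fun θ => φ (Real.sin θ)) Real.pi
  simp only [Real.sin_add_pi, zero_add] at h2
  rw [show Real.pi + Real.pi = 2 * Real.pi by ring] at h2
  rw [← h1, ← h2, integral_comp_sin_pi h, integral_comp_sin_pi (φ := fun s => φ (-s)) hm,
    intervalIntegral.integral_add (h.intervalIntegrable _ _) (hm.intervalIntegrable _ _)]
  ring

variable {l : ℝ}

lemma coordInv_eq_steady_iff (hl : 1 < l) {s : ℝ} : coordInv l s = steady l ↔ s = 0 := by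
  rw [← coordInv_zero hl]
  exact (coordInv_spec hl).2.1.injective.eq_iff

lemma tempo_of_ne (hl : 1 < l) {s : ℝ} (hs : s ≠ 0) : tempo l s =
    √(2 * potential l (coordInv l s) / potentialD1 l (coordInv l s) ^ 2) := by
  rw [tempo, speed_of_ne (by rwa [ne_eq, coordInv_eq_steady_iff hl]), Real.sqrt_inv, inv_inv]

lemma tempo_zero (hl : 1 < l) : tempo l 0 = (√(2 * l))⁻¹ := by
  rw [tempo, coordInv_zero hl, speed, if_pos rfl]

/-- Along `coordInv`, `tempo`² = 2V/V'² has x-derivative 2N and dx/ds = `tempo`, so 2 `tempo`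
`tempo`' = 2N `tempo`. -/
lemma hasDerivAt_tempo (hl : 1 < l) {s : ℝ} (hs : -√(2 * pMax l) < s) (h0 : s ≠ 0) :
    HasDerivAt (tempo l) (chiconeN l (coordInv l s)) s := by
  have hne : coordInv l s ≠ steady l := by rwa [ne_eq, coordInv_eq_steady_iff hl]
  have hx := coordInv_pos hl hs
  have hV := potential_pos hl hx.le hne
  have hV1 := potentialD1_ne hl hx hne
  have hpos : 0 < 2 * potential l (coordInv l s) / potentialD1 l (coordInv l s) ^ 2 := by
    positivity
  have h1 := ((hasDerivAt_potential_div hl hx hne).comp s (hasDerivAt_coordInv hl hs)).sqrt hpos.ne'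
  have h2 := h1.congr_of_eventuallyEq (f₁ := tempo l) (by
    filter_upwards [isOpen_ne.mem_nhds h0] with t ht using tempo_of_ne hl ht)
  refine h2.congr_deriv ?_
  have h3 := tempo_of_ne hl h0
  have h4 : 0 < √(2 * potential l (coordInv l s) / potentialD1 l (coordInv l s) ^ 2) :=
    Real.sqrt_pos.2 hpos
  simp only [Function.comp_apply]
  rw [h3]
  field_simp

/-- The even part of `tempo`, doubled. -/
def tempoSum (l s : ℝ) : ℝ := tempo l s + tempo l (-s)

lemma tempoSum_pos (hl : 1 < l) {s : ℝ} (hs : |s| < √(2 * pMax l)) : 0 < tempoSum l s := by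
  rw [abs_lt] at hs
  exact add_pos (tempo_pos hl hs.1) (tempo_pos hl (by linarith))

lemma continuousAt_tempoSum (hl : 1 < l) {s : ℝ} (hs : |s| < √(2 * pMax l)) :
    ContinuousAt (tempoSum l) s := by
  rw [abs_lt] at hs
  exact (continuousAt_tempo hl hs.1).add
    (ContinuousAt.comp (f := fun s => -s) (continuousAt_tempo hl (by linarith))
      continuousAt_neg)

lemma hasDerivAt_tempoSum (hl : 1 < l) {s : ℝ} (h0 : 0 < s) (hs : s < √(2 * pMax l)) :
    HasDerivAt (tempoSum l) (chiconeN l (coordInv l s) - chiconeN l (coordInv l (-s))) s := by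
  have h1 := hasDerivAt_tempo hl (show -√(2 * pMax l) < s by linarith) h0.ne'
  have h2 := (hasDerivAt_tempo hl (show -√(2 * pMax l) < -s by linarith) (by linarith)).comp s
    (hasDerivAt_neg s)
  exact (h1.add h2).congr_deriv (by ring)

lemma continuousOn_tempoSum (hl : 1 < l) : ContinuousOn (tempoSum l) (Ico 0 √(2 * pMax l)) :=
  fun s hs => (continuousAt_tempoSum hl (by rw [abs_of_nonneg hs.1]; exact hs.2)).continuousWithinAt

lemma coordInv_neg_lt (hl : 1 < l) {s : ℝ} (h0 : 0 < s) :
    coordInv l (-s) < steady l ∧ steady l < coordInv l s := by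
  rw [← coordInv_zero hl]
  exact ⟨(coordInv_spec hl).2.1 (by linarith), (coordInv_spec hl).2.1 h0⟩

/-- The derivative is the difference of N at the points x with H(x) = s and H(x) = -s, which lie on
opposite sides of the steady state. -/
lemma strictMonoOn_tempoSum (hl : 2 < l) : StrictMonoOn (tempoSum l) (Ico 0 √(2 * pMax l)) := by
  have hl1 : 1 < l := by linarith
  refine strictMonoOn_of_deriv_pos (convex_Ico _ _) (continuousOn_tempoSum hl1) fun s hs => ?_
  rw [interior_Ico] at hs
  rw [(hasDerivAt_tempoSum hl1 hs.1 hs.2).deriv]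
  obtain ⟨h1, h2⟩ := coordInv_neg_lt hl1 hs.1
  linarith [chiconeN_lt hl (coordInv_pos hl1 (show -√(2 * pMax l) < -s by linarith [hs.2])) h1 h2]

lemma strictAntiOn_tempoSum (hl : 4 / 3 ≤ l) (hl2 : l < 2) :
    StrictAntiOn (tempoSum l) (Ico 0 √(2 * pMax l)) := by
  have hl1 : 1 < l := by linarith
  refine strictAntiOn_of_deriv_neg (convex_Ico _ _) (continuousOn_tempoSum hl1) fun s hs => ?_
  rw [interior_Ico] at hs
  rw [(hasDerivAt_tempoSum hl1 hs.1 hs.2).deriv]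
  obtain ⟨h1, h2⟩ := coordInv_neg_lt hl1 hs.1
  linarith [chiconeN_gt hl hl2
    (coordInv_pos hl1 (show -√(2 * pMax l) < -s by linarith [hs.2])) h1 h2]

/-- For λ = 2 the potential is the perfect square 2(x - 1/8)², so the motion is isochronous with
frequency 2. -/
lemma tempo_two {s : ℝ} (hs : -√(2 * pMax 2) < s) : tempo 2 s = 1 / 2 := by
  have hl : (1:ℝ) < 2 := by norm_num
  by_cases h0 : s = 0
  · rw [h0, tempo_zero hl]
    have : (2 * 2 : ℝ) = 2 ^ 2 := by norm_num
    rw [this, Real.sqrt_sq (by norm_num)]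
    norm_num
  · have hx := coordInv_pos hl hs
    have hne : coordInv 2 s ≠ steady 2 := by rwa [ne_eq, coordInv_eq_steady_iff hl]
    have hV1 := potentialD1_ne hl hx hne
    have key : 2 * potential 2 (coordInv 2 s) / potentialD1 2 (coordInv 2 s) ^ 2 = (1 / 2) ^ 2 := by
      rw [div_eq_iff (pow_ne_zero 2 hV1), potential_eq hl hx, potentialD1, forceRatio, pMax,
        show (-2 / 2 : ℝ) = -1 by norm_num, Real.rpow_neg_one, show (2 - 1 : ℝ) = 1 by norm_num,
        Real.rpow_one]
      field_simp
      ring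
    rw [tempo_of_ne hl h0, key, Real.sqrt_sq (by norm_num)]

lemma continuous_tempo_mul_sin (hl : 1 < l) {r : ℝ} (h0 : 0 ≤ r) (hr : r < √(2 * pMax l)) :
    Continuous fun θ => tempo l (r * Real.sin θ) :=
  continuous_iff_continuousAt.2 fun θ => ContinuousAt.comp (f := fun θ => r * Real.sin θ)
    (continuousAt_tempo hl (neg_lt_mul_sin h0 hr θ)) (by fun_prop)

lemma abs_mul_sin_lt {r h₀ : ℝ} (hr : 0 ≤ r) (hh : r < h₀) (θ : ℝ) : |r * Real.sin θ| < h₀ := by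
  rw [abs_mul, abs_of_nonneg hr]
  nlinarith [Real.abs_sin_le_one θ]

lemma continuous_tempoSum_mul_sin (hl : 1 < l) {r : ℝ} (h0 : 0 ≤ r) (hr : r < √(2 * pMax l)) :
    Continuous fun θ => tempoSum l (r * Real.sin θ) :=
  continuous_iff_continuousAt.2 fun θ => ContinuousAt.comp (f := fun θ => r * Real.sin θ)
    (continuousAt_tempoSum hl (abs_mul_sin_lt h0 hr θ)) (by fun_prop)

lemma ellipticPeriod_eq (hl : 1 < l) {r : ℝ} (h0 : 0 ≤ r) (hr : r < √(2 * pMax l)) :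
    ellipticPeriod l r = 2 * ∫ θ in (0:ℝ)..(Real.pi / 2), tempoSum l (r * Real.sin θ) := by
  rw [ellipticPeriod, integral_comp_sin_two_pi (φ := fun s => tempo l (r * s))
    (continuous_tempo_mul_sin hl h0 hr)]
  simp only [mul_neg, tempoSum]

lemma strictMonoOn_integral_sin {S : ℝ → ℝ} {h₀ : ℝ} (hS : StrictMonoOn S (Ico 0 h₀))
    (hc : ∀ r, 0 ≤ r → r < h₀ → Continuous fun θ => S (r * Real.sin θ)) :
    StrictMonoOn (fun r => ∫ θ in (0:ℝ)..(Real.pi / 2), S (r * Real.sin θ)) (Ico 0 h₀) := by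
  intro r hr r' hr' hrr
  have hpi := Real.pi_pos
  have hs : ∀ θ ∈ Ioc 0 (Real.pi / 2), 0 < Real.sin θ ∧ Real.sin θ ≤ 1 := fun θ hθ =>
    ⟨Real.sin_pos_of_pos_of_lt_pi hθ.1 (by linarith [hθ.2]), Real.sin_le_one θ⟩
  have hlt : ∀ θ ∈ Ioc 0 (Real.pi / 2), S (r * Real.sin θ) < S (r' * Real.sin θ) := by
    intro θ hθ
    obtain ⟨h1, h2⟩ := hs θ hθ
    have := hr.2
    have := hr'.2
    have := hr.1
    have := hr'.1
    exact hS ⟨by positivity, by nlinarith⟩ ⟨by positivity, by nlinarith⟩ (by nlinarith)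
  exact intervalIntegral.integral_lt_integral_of_continuousOn_of_le_of_exists_lt (by positivity)
    (hc r hr.1 hr.2).continuousOn (hc r' hr'.1 hr'.2).continuousOn (fun θ hθ => (hlt θ hθ).le)
    ⟨Real.pi / 2, ⟨by positivity, le_rfl⟩, hlt _ ⟨by positivity, le_rfl⟩⟩

lemma strictMonoOn_ellipticPeriod (hl : 2 < l) :
    StrictMonoOn (ellipticPeriod l) (Ico 0 √(2 * pMax l)) := by
  have hl1 : 1 < l := by linarith
  intro r hr r' hr' hrr
  rw [ellipticPeriod_eq hl1 hr.1 hr.2, ellipticPeriod_eq hl1 hr'.1 hr'.2]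
  have := strictMonoOn_integral_sin (strictMonoOn_tempoSum hl)
    (fun r h0 h1 => continuous_tempoSum_mul_sin hl1 h0 h1) hr hr' hrr
  exact mul_lt_mul_of_pos_left this two_pos

lemma strictAntiOn_ellipticPeriod (hl : 4 / 3 ≤ l) (hl2 : l < 2) :
    StrictAntiOn (ellipticPeriod l) (Ico 0 √(2 * pMax l)) := by
  have hl1 : 1 < l := by linarith
  intro r hr r' hr' hrr
  rw [ellipticPeriod_eq hl1 hr.1 hr.2, ellipticPeriod_eq hl1 hr'.1 hr'.2]
  have := strictMonoOn_integral_sin (S := fun s => -tempoSum l s)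
    (strictAntiOn_tempoSum hl hl2).neg
    (fun r h0 h1 => (continuous_tempoSum_mul_sin hl1 h0 h1).neg) hr hr' hrr
  simp only [intervalIntegral.integral_neg, neg_lt_neg_iff] at this
  exact mul_lt_mul_of_pos_left this two_pos

lemma ellipticPeriod_two {r : ℝ} (h0 : 0 ≤ r) (hr : r < √(2 * pMax 2)) :
    ellipticPeriod 2 r = Real.pi := by
  have : ∀ θ, tempo 2 (r * Real.sin θ) = 1 / 2 := fun θ => tempo_two (neg_lt_mul_sin h0 hr θ)
  simp only [ellipticPeriod, this, intervalIntegral.integral_const, smul_eq_mul]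
  ring

lemma ellipticPeriod_zero (hl : 1 < l) : ellipticPeriod l 0 = 2 * Real.pi / √(2 * l) := by
  simp only [ellipticPeriod, zero_mul, tempo_zero hl, intervalIntegral.integral_const, smul_eq_mul]
  ring

lemma continuousOn_ellipticPeriod (hl : 1 < l) :
    ContinuousOn (ellipticPeriod l) (Ico 0 √(2 * pMax l)) := by
  intro r hr
  obtain ⟨r₁, h1, h2⟩ := exists_between hr.2
  have hr1 : 0 ≤ r₁ := hr.1.trans h1.le
  -- Truncation at -r₁ makes the integrand continuous on the whole plane without changing it for 0 ≤
  -- r < r₁.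
  have hc : Continuous fun q : ℝ × ℝ => tempo l (max (-r₁) (q.1 * Real.sin q.2)) :=
    continuous_iff_continuousAt.2 fun q =>
      ContinuousAt.comp (f := fun q : ℝ × ℝ => max (-r₁) (q.1 * Real.sin q.2))
        (continuousAt_tempo hl (lt_max_of_lt_left (by linarith)))
        (by fun_prop)
  have h3 := intervalIntegral.continuous_parametric_intervalIntegral_of_continuous'
    (μ := MeasureTheory.volume) (f := fun r θ => tempo l (max (-r₁) (r * Real.sin θ)))
    hc 0 (2 * Real.pi)
  refine (h3.continuousAt (x := r)).continuousWithinAt.congr_of_eventuallyEq ?_ ?_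
  · filter_upwards [self_mem_nhdsWithin, nhdsWithin_le_nhds (gt_mem_nhds h1)] with s hs hs1
    rw [ellipticPeriod]
    congr 1
    ext θ
    rw [max_eq_right (neg_lt_mul_sin hs.1 hs1 θ).le]
  · rw [ellipticPeriod]
    congr 1
    ext θ
    rw [max_eq_right (neg_lt_mul_sin hr.1 h1 θ).le]

/-! ### The limit of the elliptic period at zero pressure -/

/-- A primitive of `θ ↦ tempo l (√(2 * pMax l) * sin θ)`. -/
def tempoPrimitive (l θ : ℝ) : ℝ :=
  Real.arcsin (l * coordInv l (√(2 * pMax l) * Real.sin θ) ^ (1 / l))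

lemma continuous_tempoPrimitive (hl : 1 < l) : Continuous (tempoPrimitive l) := by
  have h1 := (coordInv_spec hl).1
  have h2 := Real.continuous_rpow_const (show 0 ≤ 1 / l by positivity)
  unfold tempoPrimitive
  exact Real.continuous_arcsin.comp (continuous_const.mul (h2.comp (h1.comp (by fun_prop))))

/-- The law of energy at zero pressure. -/
lemma sq_cos_eq (hl : 1 < l) {θ : ℝ} (hx : 0 < coordInv l (√(2 * pMax l) * Real.sin θ)) :
    (√(2 * pMax l) * Real.cos θ) ^ 2 =
      (coordInv l (√(2 * pMax l) * Real.sin θ) ^ (1 - 1 / l)) ^ 2 *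
        (1 - (l * coordInv l (√(2 * pMax l) * Real.sin θ) ^ (1 / l)) ^ 2) := by
  have hp := pMax_pos hl
  have h0 : -√(2 * pMax l) ≤ √(2 * pMax l) * Real.sin θ := by
    nlinarith [Real.neg_one_le_sin θ, Real.sqrt_nonneg (2 * pMax l)]
  have h1 := coord_sq hl hx.le
  rw [coord_coordInv hl h0] at h1
  set x := coordInv l (√(2 * pMax l) * Real.sin θ) with hxdef
  have h2 : (x ^ (1 - 1 / l)) ^ 2 = x ^ ((2 * l - 2) / l) := by
    rw [← Real.rpow_natCast, ← Real.rpow_mul hx.le]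
    congr 1
    field_simp
    push_cast
    ring
  have h3 : x ^ (1 - 1 / l) * x ^ (1 / l) = x := by
    rw [← Real.rpow_add hx, sub_add_cancel, Real.rpow_one]
  have h4 := Real.sq_sqrt (show 0 ≤ 2 * pMax l by positivity)
  have h5 := Real.sin_sq_add_cos_sq θ
  rw [potential] at h1
  calc (√(2 * pMax l) * Real.cos θ) ^ 2 = x ^ ((2 * l - 2) / l) - l ^ 2 * x ^ 2 := by
        linear_combination h4 + √(2 * pMax l) ^ 2 * h5 - h1
    _ = (x ^ (1 - 1 / l)) ^ 2 - l ^ 2 * (x ^ (1 - 1 / l) * x ^ (1 / l)) ^ 2 := by rw [h2, h3]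
    _ = _ := by ring

/-- At zero pressure u = λ x^(1/λ) satisfies u'² = 1 - u², so arcsin u is elapsed time on the rising
half of the orbit, from x = 0 to the apex. -/
lemma hasDerivAt_tempoPrimitive (hl : 1 < l) {θ : ℝ} (h1 : -(Real.pi / 2) < θ)
    (h2 : θ < Real.pi / 2) :
    HasDerivAt (tempoPrimitive l) (tempo l (√(2 * pMax l) * Real.sin θ)) θ := by
  have hp := pMax_pos hl
  have hh : 0 < √(2 * pMax l) := by positivity
  have hcos : 0 < Real.cos θ := Real.cos_pos_of_mem_Ioo ⟨h1, h2⟩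
  have hs1 : -1 < Real.sin θ := by
    have := Real.sin_lt_sin_of_lt_of_le_pi_div_two (x := -(Real.pi / 2)) le_rfl h2.le h1
    simpa using this
  have hs : -√(2 * pMax l) < √(2 * pMax l) * Real.sin θ := by nlinarith
  have hx := coordInv_pos hl hs
  have hE := sq_cos_eq hl hx
  have hd := hasDerivAt_coordInv hl hs
  have hd1 : HasDerivAt (fun θ => coordInv l (√(2 * pMax l) * Real.sin θ))
      (tempo l (√(2 * pMax l) * Real.sin θ) * (√(2 * pMax l) * Real.cos θ)) θ :=
    hd.comp θ ((Real.hasDerivAt_sin θ).const_mul _)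
  have hd2 := (hd1.rpow_const (p := 1 / l) (Or.inl hx.ne')).const_mul l
  set x := coordInv l (√(2 * pMax l) * Real.sin θ) with hxdef
  have hxp : 0 < x ^ (1 - 1 / l) := Real.rpow_pos_of_pos hx _
  have hup : 0 < l * x ^ (1 / l) := mul_pos (by linarith) (Real.rpow_pos_of_pos hx _)
  have hu1 : 0 < 1 - (l * x ^ (1 / l)) ^ 2 := by
    have h3 : 0 < (√(2 * pMax l) * Real.cos θ) ^ 2 := by positivity
    rw [hE] at h3
    exact pos_of_mul_pos_right h3 (by positivity)
  have hu : l * x ^ (1 / l) < 1 := by nlinarith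
  have hsq : √(2 * pMax l) * Real.cos θ = x ^ (1 - 1 / l) * √(1 - (l * x ^ (1 / l)) ^ 2) := by
    rw [← Real.sqrt_sq (show 0 ≤ √(2 * pMax l) * Real.cos θ by positivity), hE,
      Real.sqrt_mul (by positivity), Real.sqrt_sq hxp.le]
  have hfin := (Real.hasDerivAt_arcsin (x := l * x ^ (1 / l)) (by linarith) hu.ne).comp θ hd2
  refine hfin.congr_deriv ?_
  have h5 : 0 < √(1 - (l * x ^ (1 / l)) ^ 2) := Real.sqrt_pos.2 hu1
  have h6 : x ^ (1 / l - 1) * x ^ (1 - 1 / l) = 1 := by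
    rw [← Real.rpow_add hx]
    simp
  rw [hsq]
  generalize x ^ (1 / l - 1) = a at *
  generalize x ^ (1 - 1 / l) = b at *
  generalize √(1 - (l * x ^ (1 / l)) ^ 2) = w at *
  field_simp
  linear_combination tempo l (√(2 * pMax l) * Real.sin θ) * h6

lemma tempoPrimitive_top (hl : 1 < l) : tempoPrimitive l (Real.pi / 2) = Real.pi / 2 := by
  have hp := pMax_pos hl
  have hh : 0 < √(2 * pMax l) := by positivity
  have hx : 0 < coordInv l (√(2 * pMax l) * Real.sin (Real.pi / 2)) := by
    rw [Real.sin_pi_div_two]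
    exact coordInv_pos hl (by linarith)
  have hE := sq_cos_eq hl hx
  rw [tempoPrimitive]
  set x := coordInv l (√(2 * pMax l) * Real.sin (Real.pi / 2)) with hxdef
  have hxp : 0 < x ^ (1 - 1 / l) := Real.rpow_pos_of_pos hx _
  have hup : 0 < l * x ^ (1 / l) := mul_pos (by linarith) (Real.rpow_pos_of_pos hx _)
  rw [Real.cos_pi_div_two, mul_zero, zero_pow two_ne_zero, eq_comm, mul_eq_zero] at hE
  have h1 : (l * x ^ (1 / l)) ^ 2 = 1 := by
    rcases hE with h | h
    · exact absurd h (by positivity)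
    · linarith
  have h2 : l * x ^ (1 / l) = 1 := by
    nlinarith
  rw [h2, Real.arcsin_one]

lemma tempoPrimitive_bot (hl : 1 < l) : tempoPrimitive l (-(Real.pi / 2)) = 0 := by
  have : 1 / l ≠ 0 := by positivity
  rw [tempoPrimitive, Real.sin_neg, Real.sin_pi_div_two, mul_neg_one, coordInv_neg_sqrt hl,
    Real.zero_rpow this, mul_zero, Real.arcsin_zero]

lemma integral_tempoSum_critical (hl : 1 < l) :
    IntervalIntegrable (fun θ => tempoSum l (√(2 * pMax l) * Real.sin θ)) MeasureTheory.volume 0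
      (Real.pi / 2) ∧
    ∫ θ in (0:ℝ)..(Real.pi / 2), tempoSum l (√(2 * pMax l) * Real.sin θ) = Real.pi / 2 := by
  have hpi := Real.pi_pos
  have hp := pMax_pos hl
  have hh : 0 < √(2 * pMax l) := by positivity
  have hG := continuous_tempoPrimitive hl
  have hc : ContinuousOn (fun θ => tempoPrimitive l θ - tempoPrimitive l (-θ))
      (Icc 0 (Real.pi / 2)) := by fun_prop
  have hd : ∀ θ ∈ Ioo 0 (Real.pi / 2), HasDerivAt
      (fun θ => tempoPrimitive l θ - tempoPrimitive l (-θ))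
      (tempoSum l (√(2 * pMax l) * Real.sin θ)) θ := by
    intro θ hθ
    have h1 := hasDerivAt_tempoPrimitive hl (θ := θ) (by linarith [hθ.1]) hθ.2
    have h2 := (hasDerivAt_tempoPrimitive hl (θ := -θ) (by linarith [hθ.2])
      (by linarith [hθ.1])).comp θ (hasDerivAt_neg θ)
    refine (h1.sub h2).congr_deriv ?_
    rw [tempoSum, Real.sin_neg, mul_neg]
    ring_nf
  have hpos : ∀ θ ∈ Ioo 0 (Real.pi / 2), 0 ≤ tempoSum l (√(2 * pMax l) * Real.sin θ) := by
    intro θ hθ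
    refine (tempoSum_pos hl ?_).le
    have h1 : 0 < Real.sin θ := Real.sin_pos_of_pos_of_lt_pi hθ.1 (by linarith [hθ.2])
    have h2 : Real.sin θ < 1 := by
      have := Real.sin_lt_sin_of_lt_of_le_pi_div_two (x := θ) (by linarith [hθ.1]) le_rfl hθ.2
      simpa using this
    rw [abs_of_pos (by positivity)]
    nlinarith
  -- At θ = π/2 the argument -√(2 P_max) sin θ reaches the boundary x = 0. Integrability comes from
  -- the integrand being the nonnegative derivative of a continuous function.
  have hint := intervalIntegral.intervalIntegrable_deriv_of_nonneg
    (a := 0) (b := Real.pi / 2) (g := fun θ => tempoPrimitive l θ - tempoPrimitive l (-θ))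
    (g' := fun θ => tempoSum l (√(2 * pMax l) * Real.sin θ))
    (by rwa [uIcc_of_le (by positivity)])
    (by rwa [min_eq_left (by positivity), max_eq_right (by positivity)])
    (by rwa [min_eq_left (by positivity), max_eq_right (by positivity)])
  refine ⟨hint, ?_⟩
  rw [intervalIntegral.integral_eq_sub_of_hasDerivAt_of_le (by positivity) hc hd hint]
  simp [tempoPrimitive_top hl, tempoPrimitive_bot hl]

lemma tempoSum_monotone_or_antitone (hl : 4 / 3 ≤ l) :
    MonotoneOn (tempoSum l) (Ico 0 √(2 * pMax l)) ∨
      AntitoneOn (tempoSum l) (Ico 0 √(2 * pMax l)) := by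
  rcases lt_trichotomy l 2 with h | h | h
  · exact Or.inr (strictAntiOn_tempoSum hl h).antitoneOn
  · left
    subst h
    intro s hs t ht _
    have : ∀ s ∈ Ico 0 √(2 * pMax 2), tempoSum 2 s = 1 := by
      intro s hs
      rw [tempoSum, tempo_two (by linarith [hs.1, hs.2]), tempo_two (by linarith [hs.1, hs.2])]
      norm_num
    rw [this s hs, this t ht]
  · exact Or.inl (strictMonoOn_tempoSum h).monotoneOn

lemma tendsto_ellipticPeriod (hl : 4 / 3 ≤ l) :
    Tendsto (ellipticPeriod l) (𝓝[<] √(2 * pMax l)) (𝓝 Real.pi) := by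
  have hl1 : 1 < l := by linarith
  have hpi := Real.pi_pos
  have hp := pMax_pos hl1
  obtain ⟨h₀, hh₀⟩ : ∃ h₀, h₀ = √(2 * pMax l) := ⟨_, rfl⟩
  have hh : 0 < h₀ := by rw [hh₀]; positivity
  obtain ⟨hint, hval⟩ := integral_tempoSum_critical hl1
  have hmono := tempoSum_monotone_or_antitone hl
  have hpos := fun s => tempoSum_pos hl1 (s := s)
  have hcont := fun s => continuousAt_tempoSum hl1 (s := s)
  have hcs := fun r => continuous_tempoSum_mul_sin hl1 (r := r)
  have heq := fun r => ellipticPeriod_eq hl1 (r := r)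
  rw [← hh₀] at *
  have hev : ∀ᶠ r in 𝓝[<] h₀, 0 < r ∧ r < h₀ := by
    filter_upwards [Ioo_mem_nhdsLT hh] with r hr using hr
  -- The angle π/2 is discarded because there h₀ sin θ = h₀ leaves the interval on which `tempoSum`
  -- is controlled.
  have hae : ∀ᵐ θ : ℝ, θ ∈ uIoc 0 (Real.pi / 2) → 0 < Real.sin θ ∧ Real.sin θ < 1 := by
    have : ∀ᵐ θ : ℝ, θ ≠ Real.pi / 2 := MeasureTheory.Measure.ae_ne _ _
    filter_upwards [this] with θ hne hθ
    rw [uIoc_of_le (by positivity)] at hθ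
    refine ⟨Real.sin_pos_of_pos_of_lt_pi hθ.1 (by linarith [hθ.2]), ?_⟩
    have := Real.sin_lt_sin_of_lt_of_le_pi_div_two (x := θ) (by linarith [hθ.1]) le_rfl
      (lt_of_le_of_ne hθ.2 hne)
    simpa using this
  have hlim : Tendsto (fun r => ∫ θ in (0:ℝ)..(Real.pi / 2), tempoSum l (r * Real.sin θ))
      (𝓝[<] h₀) (𝓝 (∫ θ in (0:ℝ)..(Real.pi / 2), tempoSum l (h₀ * Real.sin θ))) := by
    -- By monotonicity the value at r sin θ is at most the one at h₀ sin θ (increasing case) or at 0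
    -- (decreasing case); their sum dominates in both.
    refine intervalIntegral.tendsto_integral_filter_of_dominated_convergence
      (fun θ => tempoSum l 0 + tempoSum l (h₀ * Real.sin θ)) ?_ ?_
      (intervalIntegrable_const.add hint) ?_
    · filter_upwards [hev] with r hr
      exact (hcs r hr.1.le hr.2).aestronglyMeasurable
    · filter_upwards [hev] with r hr
      filter_upwards [hae] with θ hθ hm
      obtain ⟨h1, h2⟩ := hθ hm
      have hr1 := hr.1
      have hr2 := hr.2
      have m1 : r * Real.sin θ ∈ Ico 0 h₀ := ⟨by positivity, by nlinarith⟩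
      have m2 : h₀ * Real.sin θ ∈ Ico 0 h₀ := ⟨by positivity, by nlinarith⟩
      have m0 : (0:ℝ) ∈ Ico 0 h₀ := ⟨le_rfl, hh⟩
      have p : ∀ s ∈ Ico 0 h₀, 0 < tempoSum l s := fun s hs =>
        hpos s (by rw [abs_of_nonneg hs.1]; exact hs.2)
      rw [Real.norm_of_nonneg (p _ m1).le]
      rcases hmono with hS | hS
      · have := hS m1 m2 (by nlinarith)
        linarith [p _ m0]
      · have := hS m0 m1 m1.1
        linarith [p _ m2]
    · filter_upwards [hae] with θ hθ hm
      obtain ⟨h1, h2⟩ := hθ hm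
      have h3 : Tendsto (fun r => r * Real.sin θ) (𝓝[<] h₀) (𝓝 (h₀ * Real.sin θ)) :=
        ((continuous_id.mul continuous_const).tendsto h₀).mono_left nhdsWithin_le_nhds
      refine (hcont _ ?_).tendsto.comp h3
      rw [abs_of_pos (by positivity)]
      nlinarith
  rw [hval] at hlim
  have := hlim.const_mul 2
  rw [show 2 * (Real.pi / 2) = Real.pi by ring] at this
  refine this.congr' ?_
  filter_upwards [hev] with r hr
  rw [heq r hr.1.le hr.2]

end

/-! ### Hyperbolic orbits as rotations and the life-span integral -/

section


/-- The quotient `(1 - ξ^((2λ-2)/λ)) / (1 - ξ²)`, continuously extended to `ξ = 1`. -/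
def massQuot (l ξ : ℝ) : ℝ :=
  if ξ = 1 then (l - 1) / l else (1 - ξ ^ ((2 * l - 2) / l)) / (1 - ξ ^ 2)

variable {l ξ : ℝ}

/-- The lower bound makes `massQuot` positive on ξ ≥ 0, the upper bound keeps it below 1 for ξ > 0.
-/
lemma mass_exponent_bounds (hl : 1 < l) :
    0 < (2 * l - 2) / l ∧ (2 * l - 2) / l < 2 := by
  constructor
  · exact div_pos (by linarith) (by linarith)
  · rw [div_lt_iff₀ (by linarith)]; linarith

lemma one_sub_sq_ne (h0 : 0 ≤ ξ) (h1 : ξ ≠ 1) : 1 - ξ ^ 2 ≠ 0 := by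
  intro h
  have : (1 - ξ) * (1 + ξ) = 0 := by linear_combination h
  rcases mul_eq_zero.1 this with h | h
  · exact h1 (by linarith)
  · linarith

lemma massQuot_mul (h0 : 0 ≤ ξ) :
    massQuot l ξ * (1 - ξ ^ 2) = 1 - ξ ^ ((2 * l - 2) / l) := by
  by_cases h1 : ξ = 1
  · subst h1; simp
  · rw [massQuot, if_neg h1, div_mul_cancel₀ _ (one_sub_sq_ne h0 h1)]

lemma massQuot_pos (hl : 1 < l) (h0 : 0 ≤ ξ) : 0 < massQuot l ξ := by
  obtain ⟨hg, -⟩ := mass_exponent_bounds hl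
  by_cases h1 : ξ = 1
  · rw [massQuot, if_pos h1]; exact div_pos (by linarith) (by linarith)
  · rw [massQuot, if_neg h1]
    rcases lt_or_gt_of_ne h1 with h | h
    · exact div_pos (sub_pos.2 (Real.rpow_lt_one h0 h hg)) (by nlinarith)
    · exact div_pos_of_neg_of_neg (sub_neg.2 (Real.one_lt_rpow h hg)) (by nlinarith)

lemma massQuot_lt_one (hl : 1 < l) (h0 : 0 < ξ) : massQuot l ξ < 1 := by
  obtain ⟨hg, hg2⟩ := mass_exponent_bounds hl
  by_cases h1 : ξ = 1
  · rw [massQuot, if_pos h1, div_lt_one (by linarith)]; linarith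
  · rw [massQuot, if_neg h1]
    rcases lt_or_gt_of_ne h1 with h | h
    · have := Real.rpow_lt_rpow_of_exponent_gt h0 h hg2
      rw [Real.rpow_two] at this
      rw [div_lt_one (by nlinarith)]
      linarith
    · have := Real.rpow_lt_rpow_of_exponent_lt h hg2
      rw [Real.rpow_two] at this
      rw [div_lt_one_of_neg (by nlinarith)]
      linarith

lemma massQuot_zero (hl : 1 < l) : massQuot l 0 = 1 := by
  rw [massQuot, if_neg zero_ne_one, Real.zero_rpow (mass_exponent_bounds hl).1.ne']
  simp

lemma massQuot_le_one (hl : 1 < l) (h0 : 0 ≤ ξ) : massQuot l ξ ≤ 1 := by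
  rcases h0.eq_or_lt with h | h
  · rw [← h, massQuot_zero hl]
  · exact (massQuot_lt_one hl h).le

lemma continuousAt_massQuot (hl : 1 < l) (h0 : 0 ≤ ξ) : ContinuousAt (massQuot l) ξ := by
  obtain ⟨hg, hg2⟩ := mass_exponent_bounds hl
  have hc := Real.continuous_rpow_const hg.le
  by_cases h1 : ξ = 1
  · subst h1
    rw [continuousAt_iff_punctured_nhds]
    have hpos : ∀ᶠ ξ : ℝ in 𝓝[≠] 1, 0 < ξ :=
      nhdsWithin_le_nhds (lt_mem_nhds one_pos)
    have key : Tendsto (fun ξ : ℝ => (1 - ξ ^ ((2 * l - 2) / l)) / (1 - ξ ^ 2)) (𝓝[≠] 1)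
        (𝓝 ((l - 1) / l)) := by
      refine HasDerivAt.lhopital_zero_nhdsNE
        (f' := fun ξ => -((2 * l - 2) / l * ξ ^ ((2 * l - 2) / l - 1)))
        (g' := fun ξ => -(2 * ξ)) ?_ ?_ ?_ ?_ ?_ ?_
      · filter_upwards [hpos] with ξ h
        exact (Real.hasDerivAt_rpow_const (Or.inl h.ne')).const_sub 1
      · filter_upwards with ξ
        exact ((hasDerivAt_pow 2 ξ).const_sub 1).congr_deriv (by push_cast; ring)
      · filter_upwards [hpos] with ξ h
        exact neg_ne_zero.2 (by positivity)
      · have := (continuous_const.sub hc : Continuous fun ξ : ℝ => 1 - ξ ^ ((2 * l - 2) / l))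
        have := this.tendsto 1
        rw [Pi.sub_apply, Real.one_rpow, sub_self] at this
        exact this.mono_left nhdsWithin_le_nhds
      · have : Continuous fun ξ : ℝ => 1 - ξ ^ 2 := by fun_prop
        have := this.tendsto 1
        rw [one_pow, sub_self] at this
        exact this.mono_left nhdsWithin_le_nhds
      · have : ContinuousAt (fun ξ : ℝ => -((2 * l - 2) / l * ξ ^ ((2 * l - 2) / l - 1)) /
            -(2 * ξ)) 1 := by
          refine ContinuousAt.div ?_ (by fun_prop) (by norm_num)
          exact (continuousAt_const.mul
            (Real.continuousAt_rpow_const _ _ (Or.inl one_ne_zero))).neg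
        have h2 := this.tendsto
        rw [Real.one_rpow] at h2
        have h3 : -((2 * l - 2) / l * 1) / -(2 * 1) = (l - 1) / l := by field_simp
        rw [h3] at h2
        exact h2.mono_left nhdsWithin_le_nhds
    have h4 : massQuot l 1 = (l - 1) / l := by rw [massQuot, if_pos rfl]
    rw [h4]
    refine key.congr' ?_
    filter_upwards [self_mem_nhdsWithin] with ξ h
    rw [massQuot, if_neg (show ξ ≠ 1 from h)]
  · have h2 : ContinuousAt (fun ξ : ℝ => (1 - ξ ^ ((2 * l - 2) / l)) / (1 - ξ ^ 2)) ξ :=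
      (continuousAt_const.sub hc.continuousAt).div (by fun_prop) (one_sub_sq_ne h0 h1)
    refine h2.congr ?_
    filter_upwards [isOpen_ne.mem_nhds h1] with y hy
    rw [massQuot, if_neg hy]

lemma one_sub_mul_massQuot_pos (hl : 1 < l) {m : ℝ} (hm : m < 1) (h0 : 0 ≤ ξ) :
    0 < 1 - m * massQuot l ξ := by
  have h1 := massQuot_pos hl h0
  have h2 := massQuot_le_one hl h0
  rcases le_total m 0 with h | h <;> nlinarith

/-- The angular speed of hyperbolic orbits, in terms of the distance `ξ` to the boundary relative
to its maximum. -/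
def angularSpeed (l m ξ : ℝ) : ℝ := l * √(1 - m * massQuot l ξ)

lemma angularSpeed_pos (hl : 1 < l) {m : ℝ} (hm : m < 1) (h0 : 0 ≤ ξ) :
    0 < angularSpeed l m ξ :=
  mul_pos (by linarith) (Real.sqrt_pos.2 (one_sub_mul_massQuot_pos hl hm h0))

lemma angularSpeed_sq (hl : 1 < l) {m : ℝ} (hm : m < 1) (h0 : 0 ≤ ξ) :
    angularSpeed l m ξ ^ 2 = l ^ 2 * (1 - m * massQuot l ξ) := by
  rw [angularSpeed, mul_pow, Real.sq_sqrt (one_sub_mul_massQuot_pos hl hm h0).le]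

lemma continuousAt_angularSpeed (hl : 1 < l) (m : ℝ) (h0 : 0 ≤ ξ) :
    ContinuousAt (angularSpeed l m) ξ :=
  continuousAt_const.mul
    (continuousAt_const.sub (continuousAt_const.mul (continuousAt_massQuot hl h0))).sqrt

/-- The life-span of the hyperbolic orbits with parameter `m`. -/
def lifeSpan (l m : ℝ) : ℝ := ∫ θ in (0:ℝ)..Real.pi, (angularSpeed l m |Real.sin θ|)⁻¹

lemma continuous_inv_angularSpeed (hl : 1 < l) {m : ℝ} (hm : m < 1) :
    Continuous fun θ => (angularSpeed l m |Real.sin θ|)⁻¹ :=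
  continuous_iff_continuousAt.2 fun θ =>
    (ContinuousAt.comp (f := fun θ => |Real.sin θ|) (continuousAt_angularSpeed hl m (abs_nonneg _))
      (by fun_prop)).inv₀ (angularSpeed_pos hl hm (abs_nonneg _)).ne'

/-- The force of the Hamiltonian system. -/
def force (l B x : ℝ) : ℝ := -l ^ 2 * x + (l - 1) / l * B * x ^ ((l - 2) / l)

lemma continuousAt_force {B x : ℝ} (hx : 0 < x) : ContinuousAt (force l B) x := by
  unfold force
  have := Real.continuousAt_rpow_const x ((l - 2) / l) (Or.inl hx.ne')
  fun_prop

lemma hasDerivAt_energy (hl : 1 < l) {P B x : ℝ} (hx : 0 < x) :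
    HasDerivAt (fun x => -2 * P - l ^ 2 * x ^ 2 + B * x ^ ((2 * l - 2) / l))
      (2 * force l B x) x := by
  have h1 := (Real.hasDerivAt_rpow_const (p := (2 * l - 2) / l) (Or.inl hx.ne')).const_mul B
  have h2 := (((hasDerivAt_pow 2 x).const_mul (l ^ 2)).const_sub (-2 * P)).add h1
  refine h2.congr_deriv ?_
  have : (2 * l - 2) / l - 1 = (l - 2) / l := by field_simp; ring
  rw [this, force]
  push_cast
  field_simp

/-- The left side vanishes at the turning point r. Subtracting its value there gives λ²(r² - x²) -
B(r^γ - x^γ) with γ = (2λ-2)/λ, and `massQuot` extracts the factor r² - x² from the second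
difference. -/
lemma energy_eq (hl : 1 < l) {P B r m x : ℝ} (hr : 0 < r) (hm : m < 1)
    (hB : B * r ^ (-2 / l) = m * l ^ 2) (hP : -2 * P = l ^ 2 * r ^ 2 * (1 - m)) (hx : 0 < x) :
    -2 * P - l ^ 2 * x ^ 2 + B * x ^ ((2 * l - 2) / l) =
      angularSpeed l m (x / r) ^ 2 * (r ^ 2 - x ^ 2) := by
  have hξ : 0 < x / r := by positivity
  rw [angularSpeed_sq hl hm hξ.le]
  have h1 := massQuot_mul (l := l) hξ.le
  have h2 : x ^ ((2 * l - 2) / l) = r ^ 2 * r ^ (-2 / l) * (x / r) ^ ((2 * l - 2) / l) := by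
    rw [← rpow_mass_exponent hl hr, ← Real.mul_rpow hr.le hξ.le, mul_div_cancel₀ _ hr.ne']
  have h3 : x = r * (x / r) := by field_simp
  generalize (x / r) ^ ((2 * l - 2) / l) = w at *
  generalize massQuot l (x / r) = q at *
  rw [h2, hP]
  generalize x / r = ξ at *
  rw [h3]
  linear_combination r ^ 2 * w * hB + m * l ^ 2 * r ^ 2 * h1

/-- The turning point is not an equilibrium, which makes the zeros of y isolated. -/
lemma force_neg (hl : 1 < l) {B r m : ℝ} (hr : 0 < r) (hm : m < 1)
    (hB : B * r ^ (-2 / l) = m * l ^ 2) : force l B r < 0 := by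
  rw [force, rpow_force_exponent hl hr]
  have h1 : -l ^ 2 * r + (l - 1) / l * B * (r * r ^ (-2 / l)) = -(l * r * (l - m * (l - 1))) := by
    have : (l - 1) / l * B * (r * r ^ (-2 / l)) = (l - 1) / l * r * (B * r ^ (-2 / l)) := by ring
    rw [this, hB]
    field_simp
    ring
  rw [h1, neg_lt_zero]
  have : 0 < l - m * (l - 1) := by nlinarith
  positivity

lemma pressure_eq_iff {P B x y : ℝ} : pressure l B x y = P ↔
    y ^ 2 = -2 * P - l ^ 2 * x ^ 2 + B * x ^ ((2 * l - 2) / l) := by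
  rw [pressure]
  constructor <;> intro h <;> linarith

/-- With w = `angularSpeed l m (x / r)` and z = y/w, the pair (x, z) turns on the circle of radius r
with angular speed w. Positivity of x confines it to a half turn. -/
lemma isLifeSpan_lifeSpan (hl : 1 < l) {P B r m : ℝ} (hr : 0 < r) (hm : m < 1)
    (hB : B * r ^ (-2 / l) = m * l ^ 2) (hP : -2 * P = l ^ 2 * r ^ 2 * (1 - m)) :
    IsLifeSpan l P B (lifeSpan l m) := by
  have hpi := Real.pi_pos
  set D : ℝ → ℝ := fun θ => (angularSpeed l m |Real.sin θ|)⁻¹ with hDdef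
  have hD : Continuous D := continuous_inv_angularSpeed hl hm
  have hpos : ∀ θ, 0 < D θ := fun θ => inv_pos.2 (angularSpeed_pos hl hm (abs_nonneg _))
  -- Thanks to the absolute value the density has period π, so each half turn takes time `lifeSpan l
  -- m`; the period 2π only feeds `exists_angle`.
  have hper : Function.Periodic D Real.pi := fun θ => by
    simp only [hDdef, Real.sin_add_pi, abs_neg]
  have hper2 : Function.Periodic D (2 * Real.pi) := fun θ => by
    simp only [hDdef, Real.sin_add_two_pi]
  obtain ⟨A, hA1, hA2, hA3, hA4, hA5⟩ := exists_angle hD hpos hper2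
  have hA0 : A 0 = 0 := by simpa using hA3 0
  have hAT : A (lifeSpan l m) = Real.pi := hA3 _
  have hAper : ∀ t, A (t + lifeSpan l m) = A t + Real.pi := angle_add_period hD hA3 hA4 hper
  have hE : ∀ x, 0 < x → -2 * P - l ^ 2 * x ^ 2 + B * x ^ ((2 * l - 2) / l) =
      angularSpeed l m (x / r) ^ 2 * (r ^ 2 - x ^ 2) := fun x => energy_eq hl hr hm hB hP
  constructor
  · have hT : 0 < lifeSpan l m := by
      rw [← hA2.lt_iff_lt, hA0, hAT]; exact hpi
    have hmem : ∀ t ∈ Ioo 0 (lifeSpan l m), 0 < A t ∧ A t < Real.pi := fun t ht =>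
      ⟨by rw [← hA0]; exact hA2 ht.1, by rw [← hAT]; exact hA2 ht.2⟩
    have hsin : ∀ t ∈ Ioo 0 (lifeSpan l m), 0 < Real.sin (A t) := fun t ht =>
      Real.sin_pos_of_pos_of_lt_pi (hmem t ht).1 (hmem t ht).2
    set x : ℝ → ℝ := fun t => r * Real.sin (A t) with hx
    set y : ℝ → ℝ := fun t => r * Real.cos (A t) * angularSpeed l m |Real.sin (A t)| with hy
    have hxc : Continuous x := by fun_prop
    have hyc : Continuous y := by
      have : Continuous fun t => angularSpeed l m |Real.sin (A t)| :=
        continuous_iff_continuousAt.2 fun t => ContinuousAt.comp (f := fun t => |Real.sin (A t)|)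
          (continuousAt_angularSpeed hl m (abs_nonneg _)) (by fun_prop)
      fun_prop
    have hxpos : ∀ t ∈ Ioo 0 (lifeSpan l m), 0 < x t := fun t ht => mul_pos hr (hsin t ht)
    have hxd : ∀ t, HasDerivAt x (y t) t := by
      intro t
      refine ((hA5 t).sin.const_mul r).congr_deriv ?_
      simp only [hDdef, hy, inv_inv]
      ring
    have hysq : ∀ t ∈ Ioo 0 (lifeSpan l m), y t ^ 2 =
        -2 * P - l ^ 2 * x t ^ 2 + B * x t ^ ((2 * l - 2) / l) := by
      intro t ht
      rw [hE _ (hxpos t ht)]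
      simp only [hx, hy]
      rw [mul_div_cancel_left₀ _ hr.ne', abs_of_pos (hsin t ht)]
      linear_combination r ^ 2 * angularSpeed l m (Real.sin (A t)) ^ 2 *
        Real.sin_sq_add_cos_sq (A t)
    have hyd : ∀ t ∈ Ioo 0 (lifeSpan l m), HasDerivAt y (force l B (x t)) t := by
      intro t ht
      have hnhds : Ioo 0 (lifeSpan l m) ∈ 𝓝 t := isOpen_Ioo.mem_nhds ht
      -- `massQuot` is only known to be continuous at the apex ξ = 1, so y is differentiated through
      -- y², which the energy law makes a smooth function of x; y vanishes only where the angle is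
      -- π/2.
      refine hasDerivAt_of_sq (v := fun t => force l B (x t))
        (Eventually.of_forall fun s => hyc.continuousAt) ?_ ?_
        ((continuousAt_force (hxpos t ht)).comp hxc.continuousAt)
      · filter_upwards [hnhds] with s hs
        have h1 := (hasDerivAt_energy hl (P := P) (B := B) (hxpos s hs)).comp s (hxd s)
        refine (h1.congr_of_eventuallyEq ?_).congr_deriv (by ring)
        filter_upwards [isOpen_Ioo.mem_nhds hs] with w hw using hysq w hw
      · have hne : ∀ᶠ s in 𝓝[≠] t, A s ≠ Real.pi / 2 := by
          by_cases h : A t = Real.pi / 2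
          · filter_upwards [self_mem_nhdsWithin] with s hs
            rw [← h]
            exact hA2.injective.ne hs
          · exact nhdsWithin_le_nhds (hA1.continuousAt.eventually_ne h)
        filter_upwards [hne, nhdsWithin_le_nhds hnhds] with s h1 hs h2
        have h3 := angularSpeed_pos hl hm (abs_nonneg (Real.sin (A s)))
        have h4 : Real.cos (A s) = 0 := by
          have := (mul_eq_zero.1 h2).resolve_right h3.ne'
          exact (mul_eq_zero.1 this).resolve_left hr.ne'
        rw [← Real.cos_pi_div_two] at h4
        exact h1 (Real.injOn_cos ⟨(hmem s hs).1.le, (hmem s hs).2.le⟩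
          ⟨by positivity, by linarith⟩ h4)
    exact ⟨0, lifeSpan l m, x, y, hT, ⟨hxpos, fun t _ => hxd t, hyd⟩,
      fun t ht => pressure_eq_iff.2 (hysq t ht), hxc.continuousOn,
      by simp [hx, hA0], by simp [hx, hAT]⟩
  · rintro a b x y ⟨hab, ⟨hx, hxd, hyd⟩, hpr, hxc, hxa, hxb⟩
    set w : ℝ → ℝ := fun t => angularSpeed l m (x t / r) with hw
    have hwpos : ∀ t ∈ Ioo a b, 0 < w t := fun t ht =>
      angularSpeed_pos hl hm (div_pos (hx t ht) hr).le
    have hwc : ∀ t ∈ Ioo a b, ContinuousAt w t := fun t ht =>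
      ContinuousAt.comp (f := fun t => x t / r)
        (continuousAt_angularSpeed hl m (div_pos (hx t ht) hr).le)
        ((hxd t ht).continuousAt.div_const r)
    have hysq : ∀ t ∈ Ioo a b, y t ^ 2 = w t ^ 2 * (r ^ 2 - x t ^ 2) := fun t ht => by
      rw [pressure_eq_iff.1 (hpr t ht), hE _ (hx t ht)]
    set z : ℝ → ℝ := fun t => y t / w t with hz
    have hwz : ∀ t ∈ Ioo a b, w t * z t = y t := fun t ht =>
      mul_div_cancel₀ _ (hwpos t ht).ne'
    have hzsq : ∀ t ∈ Ioo a b, z t ^ 2 = r ^ 2 - x t ^ 2 := fun t ht => by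
      simp only [hz]
      rw [div_pow, hysq t ht, mul_div_cancel_left₀ _ (pow_pos (hwpos t ht) 2).ne']
    have hzd : ∀ t ∈ Ioo a b, HasDerivAt z (-(w t * x t)) t := by
      intro t ht
      refine hasDerivAt_of_sq (v := fun t => -(w t * x t)) ?_ ?_ ?_
        ((hwc t ht).mul (hxd t ht).continuousAt).neg
      · filter_upwards [isOpen_Ioo.mem_nhds ht] with s hs
        exact (hyd s hs).continuousAt.div (hwc s hs) (hwpos s hs).ne'
      · filter_upwards [isOpen_Ioo.mem_nhds ht] with s hs
        have h1 := ((hxd s hs).pow 2).const_sub (r ^ 2)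
        refine (h1.congr_of_eventuallyEq ?_).congr_deriv ?_
        · filter_upwards [isOpen_Ioo.mem_nhds hs] with τ hτ using hzsq τ hτ
        · rw [← hwz s hs]
          push_cast
          ring
      -- A zero of y forces x = r, where y' is the nonzero force.
      · have hy0 : ∀ᶠ s in 𝓝[≠] t, y s ≠ 0 := by
          by_cases h : y t = 0
          · have h1 := hysq t ht
            rw [h, zero_pow two_ne_zero, eq_comm, mul_eq_zero] at h1
            have h2 : r ^ 2 - x t ^ 2 = 0 := h1.resolve_left (pow_pos (hwpos t ht) 2).ne'
            have h3 : x t = r := by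
              rw [← sq_eq_sq₀ (hx t ht).le hr.le]; linarith
            have h4 := force_neg hl hr hm hB
            have h5 := hyd t ht
            rw [h3] at h5
            have := h5.eventually_ne (c := 0) h4.ne
            exact this
          · exact nhdsWithin_le_nhds ((hyd t ht).continuousAt.eventually_ne h)
        filter_upwards [hy0, nhdsWithin_le_nhds (isOpen_Ioo.mem_nhds ht)] with s h1 hs
        exact div_ne_zero h1 (hwpos s hs).ne'
    have ht₀ : (a + b) / 2 ∈ Ioo a b := ⟨by linarith, by linarith⟩
    obtain ⟨c, hc⟩ := exists_shift (H := x) (z := z) (w := w) isOpen_Ioo ordConnected_Ioo ht₀ hr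
      (fun t ht => (hwc t ht).continuousWithinAt)
      (fun t ht => (hxd t ht).congr_deriv (hwz t ht).symm) hzd
      (by rw [hzsq _ ht₀]; ring) hD hA3
      (fun t ht θ hθ => by
        have h1 : Real.sin θ = x t / r := by rw [hθ]; field_simp
        simp only [hDdef, hw]
        rw [h1, abs_of_pos (div_pos (hx t ht) hr)]
        exact inv_mul_cancel₀ (hwpos t ht).ne')
    -- At the endpoints only the continuity of x is available, so the formula is carried there by
    -- closure.
    have heq : EqOn x (fun t => r * Real.sin (A (t + c))) (Icc a b) := by
      refine EqOn.of_subset_closure (s := Ioo a b) (fun t ht => (hc t ht).1) hxc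
        (Continuous.continuousOn (by fun_prop)) Ioo_subset_Icc_self ?_
      rw [closure_Ioo hab.ne]
    have hsin : ∀ t ∈ Icc a b, x t = 0 → ∃ n : ℤ, n * Real.pi = A (t + c) := by
      intro t ht h0
      have h1 := heq ht
      rw [h0] at h1
      exact Real.sin_eq_zero_iff.1 ((mul_eq_zero.1 h1.symm).resolve_left hr.ne')
    obtain ⟨k, hk⟩ := hsin a ⟨le_rfl, hab.le⟩ hxa
    obtain ⟨n, hn⟩ := hsin b ⟨hab.le, le_rfl⟩ hxb
    have hlt : A (a + c) < A (b + c) := hA2 (by linarith)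
    have hkn : k < n := by
      rw [← hk, ← hn] at hlt
      exact_mod_cast lt_of_mul_lt_mul_right hlt hpi.le
    -- If the angle passed another multiple of π between the endpoints, x would vanish inside the
    -- open interval.
    have hnk : n = k + 1 := by
      by_contra hne
      have h2 : k + 1 < n := by omega
      have h3 : ((k + 1 : ℤ) : ℝ) * Real.pi < A (b + c) := by
        rw [← hn]
        exact mul_lt_mul_of_pos_right (by exact_mod_cast h2) hpi
      have h4 : A (a + c) < ((k + 1 : ℤ) : ℝ) * Real.pi := by
        rw [← hk]
        exact mul_lt_mul_of_pos_right (by exact_mod_cast (by omega : k < k + 1)) hpi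
      rw [← hA3 (((k + 1 : ℤ) : ℝ) * Real.pi), hA2.lt_iff_lt] at h3 h4
      have h5 : (∫ φ in (0:ℝ)..(((k + 1 : ℤ) : ℝ) * Real.pi), D φ) - c ∈ Ioo a b :=
        ⟨by linarith, by linarith⟩
      have h6 := hx _ h5
      rw [(hc _ h5).1, sub_add_cancel, hA3, Real.sin_int_mul_pi, mul_zero] at h6
      exact lt_irrefl _ h6
    have hfin : A (a + c + lifeSpan l m) = A (b + c) := by
      rw [hAper, ← hk, ← hn, hnk]
      push_cast
      ring
    have := hA2.injective hfin
    linarith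

end

/-! ### Monotonicity and limits of the life-span in `m` -/

section


variable {l : ℝ}

lemma inv_angularSpeed_lt (hl : 1 < l) {m m' ξ : ℝ} (hmm : m < m') (h0 : 0 ≤ ξ)
    (h1 : 0 < 1 - m' * massQuot l ξ) : (angularSpeed l m ξ)⁻¹ < (angularSpeed l m' ξ)⁻¹ := by
  have hq := massQuot_pos hl h0
  have hl0 : 0 < l := by linarith
  have h2 : √(1 - m' * massQuot l ξ) < √(1 - m * massQuot l ξ) :=
    Real.sqrt_lt_sqrt h1.le (by nlinarith)
  exact inv_strictAnti₀ (mul_pos hl0 (Real.sqrt_pos.2 h1)) (mul_lt_mul_of_pos_left h2 hl0)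

lemma strictMonoOn_lifeSpan (hl : 1 < l) : StrictMonoOn (lifeSpan l) (Iio 1) := by
  intro m hm m' hm' hmm
  have hpi := Real.pi_pos
  have hlt : ∀ θ, (angularSpeed l m |Real.sin θ|)⁻¹ < (angularSpeed l m' |Real.sin θ|)⁻¹ :=
    fun θ => inv_angularSpeed_lt hl hmm (abs_nonneg _)
      (one_sub_mul_massQuot_pos hl hm' (abs_nonneg _))
  exact intervalIntegral.integral_lt_integral_of_continuousOn_of_le_of_exists_lt hpi
    (continuous_inv_angularSpeed hl hm).continuousOn
    (continuous_inv_angularSpeed hl hm').continuousOn (fun θ _ => (hlt θ).le)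
    ⟨0, ⟨le_rfl, hpi.le⟩, hlt 0⟩

lemma continuousOn_lifeSpan (hl : 1 < l) : ContinuousOn (lifeSpan l) (Iio 1) := by
  intro m hm
  obtain ⟨m₁, h1, h2⟩ := exists_between (mem_Iio.1 hm)
  -- Capping m at m₁ < 1 keeps the root away from 0, so the integrand is jointly continuous
  -- everywhere.
  have hc : Continuous fun q : ℝ × ℝ => (angularSpeed l (min m₁ q.1) |Real.sin q.2|)⁻¹ := by
    refine continuous_iff_continuousAt.2 fun q => ContinuousAt.inv₀ ?_
      (angularSpeed_pos hl (min_lt_of_left_lt h2) (abs_nonneg _)).ne'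
    have hq : ContinuousAt (fun q : ℝ × ℝ => massQuot l |Real.sin q.2|) q :=
      ContinuousAt.comp (f := fun q : ℝ × ℝ => |Real.sin q.2|)
        (continuousAt_massQuot hl (abs_nonneg _)) (by fun_prop)
    have hm : ContinuousAt (fun q : ℝ × ℝ => min m₁ q.1) q := by fun_prop
    exact continuousAt_const.mul (continuousAt_const.sub (hm.mul hq)).sqrt
  have h3 := intervalIntegral.continuous_parametric_intervalIntegral_of_continuous'
    (μ := MeasureTheory.volume)
    (f := fun m θ => (angularSpeed l (min m₁ m) |Real.sin θ|)⁻¹) hc 0 Real.pi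
  refine ((h3.continuousAt (x := m)).congr ?_).continuousWithinAt
  filter_upwards [gt_mem_nhds h1] with m' hm'
  rw [lifeSpan]
  simp only [min_eq_right hm'.le]

lemma lifeSpan_zero : lifeSpan l 0 = Real.pi / l := by
  simp [lifeSpan, angularSpeed, div_eq_mul_inv]

lemma lifeSpan_eq (hl : 1 < l) {m : ℝ} (hm : m < 1) : lifeSpan l m =
    2 * ∫ θ in (0:ℝ)..(Real.pi / 2), (angularSpeed l m |Real.sin θ|)⁻¹ :=
  integral_comp_sin_pi (φ := fun s => (angularSpeed l m |s|)⁻¹) (continuous_inv_angularSpeed hl hm)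

/-- `massQuot` has a positive minimum c on [0, 1], so for m < 0 the integrand is at most 1/(λ√(1 -
mc)). -/
lemma tendsto_lifeSpan_atBot (hl : 1 < l) : Tendsto (lifeSpan l) atBot (𝓝 0) := by
  have hpi := Real.pi_pos
  have hl0 : 0 < l := by linarith
  obtain ⟨ξ₀, hξ₀, hmin⟩ := isCompact_Icc.exists_isMinOn (nonempty_Icc.2 zero_le_one)
    (fun ξ (hξ : ξ ∈ Icc (0:ℝ) 1) => (continuousAt_massQuot hl hξ.1).continuousWithinAt)
  have hc := massQuot_pos hl hξ₀.1
  set c := massQuot l ξ₀ with hcdef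
  have hlim : Tendsto (fun m => Real.pi * (l * √(1 - m * c))⁻¹) atBot (𝓝 0) := by
    have h1 : Tendsto (fun m : ℝ => 1 - m * c) atBot atTop := by
      have := tendsto_atTop_add_const_left atBot (1:ℝ)
        (tendsto_neg_atBot_atTop.comp (tendsto_id.atBot_mul_const hc))
      simpa [sub_eq_add_neg] using this
    have h2 := (Real.tendsto_sqrt_atTop.comp h1).const_mul_atTop hl0
    have h3 := (tendsto_inv_atTop_zero.comp h2).const_mul Real.pi
    simpa using h3
  refine tendsto_of_tendsto_of_tendsto_of_le_of_le' tendsto_const_nhds hlim ?_ ?_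
  · filter_upwards [eventually_lt_atBot 1] with m hm
    exact intervalIntegral.integral_nonneg hpi.le fun θ _ =>
      (inv_pos.2 (angularSpeed_pos hl hm (abs_nonneg _))).le
  · filter_upwards [eventually_lt_atBot 0] with m hm
    have hm1 : m < 1 := by linarith
    have h1 : lifeSpan l m ≤ ∫ _ in (0:ℝ)..Real.pi, (l * √(1 - m * c))⁻¹ := by
      refine intervalIntegral.integral_mono_on hpi.le
        ((continuous_inv_angularSpeed hl hm1).intervalIntegrable _ _)
        intervalIntegrable_const fun θ _ => ?_
      have h2 : c ≤ massQuot l |Real.sin θ| := hmin ⟨abs_nonneg _, Real.abs_sin_le_one θ⟩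
      have h3 : 0 < 1 - m * c := by nlinarith
      refine inv_anti₀ (mul_pos hl0 (Real.sqrt_pos.2 h3)) ?_
      exact mul_le_mul_of_nonneg_left (Real.sqrt_le_sqrt (by nlinarith)) hl0.le
    rw [intervalIntegral.integral_const, smul_eq_mul, sub_zero] at h1
    exact h1

/-- For m = 1 and s = sin θ the root simplifies: `angularSpeed` times cos θ is λ s^(1-1/λ) √(1 -
s^(2/λ)). This is the zero-pressure substitution again. -/
lemma hasDerivAt_arcsin_sin_rpow (hl : 1 < l) {θ : ℝ} (h1 : 0 < θ) (h2 : θ < Real.pi / 2) :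
    HasDerivAt (fun θ => Real.arcsin (Real.sin θ ^ (1 / l)))
      (angularSpeed l 1 |Real.sin θ|)⁻¹ θ := by
  have hl0 : 0 < l := by linarith
  have hcos : 0 < Real.cos θ := Real.cos_pos_of_mem_Ioo ⟨by linarith, h2⟩
  have hsin : 0 < Real.sin θ := Real.sin_pos_of_pos_of_lt_pi h1 (by linarith)
  have hd := (Real.hasDerivAt_sin θ).rpow_const (p := 1 / l) (Or.inl hsin.ne')
  rw [abs_of_pos hsin]
  have hsc := Real.sin_sq_add_cos_sq θ
  generalize hs : Real.sin θ = s at *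
  have hs1 : s < 1 := by nlinarith
  have hu : s ^ (1 / l) < 1 := Real.rpow_lt_one hsin.le hs1 (by positivity)
  have hup : 0 < s ^ (1 / l) := Real.rpow_pos_of_pos hsin _
  have hfin := HasDerivAt.comp (h := fun θ => Real.sin θ ^ (1 / l)) θ
    (by rw [hs]; exact Real.hasDerivAt_arcsin (x := s ^ (1 / l)) (by linarith) hu.ne) hd
  refine hfin.congr_deriv ?_
  have hu1 : 0 < 1 - (s ^ (1 / l)) ^ 2 := by nlinarith
  have hb : 0 < s ^ (1 - 1 / l) := Real.rpow_pos_of_pos hsin _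
  have hq := massQuot_mul (l := l) hsin.le
  have hg : s ^ ((2 * l - 2) / l) = (s ^ (1 - 1 / l)) ^ 2 := by
    rw [← Real.rpow_natCast, ← Real.rpow_mul hsin.le]
    congr 1
    field_simp
    push_cast
    ring
  have hsp : s ^ (1 - 1 / l) * s ^ (1 / l) = s := by
    rw [← Real.rpow_add hsin, sub_add_cancel, Real.rpow_one]
  have hab : s ^ (1 / l - 1) * s ^ (1 - 1 / l) = 1 := by
    rw [← Real.rpow_add hsin]
    simp
  have hA : angularSpeed l 1 s * Real.cos θ = l * (s ^ (1 - 1 / l) * √(1 - (s ^ (1 / l)) ^ 2)) := by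
    rw [angularSpeed, mul_assoc, one_mul]
    congr 1
    rw [← Real.sqrt_sq hcos.le, ← Real.sqrt_sq hb.le, ← Real.sqrt_mul' _ (sq_nonneg _),
      ← Real.sqrt_mul (sq_nonneg _)]
    congr 1
    rw [hg] at hq
    generalize s ^ (1 - 1 / l) = b at *
    generalize s ^ (1 / l) = u at *
    have : Real.cos θ ^ 2 = 1 - s ^ 2 := by linarith
    rw [this]
    have h5 : b ^ 2 * u ^ 2 = s ^ 2 := by rw [← mul_pow, hsp]
    linear_combination -hq + h5
  have hw : 0 < √(1 - (s ^ (1 / l)) ^ 2) := Real.sqrt_pos.2 hu1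
  have hA' : angularSpeed l 1 s =
      l * (s ^ (1 - 1 / l) * √(1 - (s ^ (1 / l)) ^ 2)) / Real.cos θ := by
    rw [← hA]; field_simp
  rw [hA']
  generalize √(1 - (s ^ (1 / l)) ^ 2) = w at *
  generalize s ^ (1 - 1 / l) = b at *
  generalize s ^ (1 / l - 1) = a at *
  field_simp
  linear_combination hab

lemma integral_inv_angularSpeed_one (hl : 1 < l) :
    IntervalIntegrable (fun θ => (angularSpeed l 1 |Real.sin θ|)⁻¹) MeasureTheory.volume 0
      (Real.pi / 2) ∧
    ∫ θ in (0:ℝ)..(Real.pi / 2), (angularSpeed l 1 |Real.sin θ|)⁻¹ = Real.pi / 2 := by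
  have hpi := Real.pi_pos
  have hl0 : 0 < l := by linarith
  have hc : Continuous fun θ => Real.arcsin (Real.sin θ ^ (1 / l)) :=
    Real.continuous_arcsin.comp ((Real.continuous_rpow_const (by positivity)).comp
      Real.continuous_sin)
  have hd : ∀ θ ∈ Ioo 0 (Real.pi / 2), HasDerivAt (fun θ => Real.arcsin (Real.sin θ ^ (1 / l)))
      (angularSpeed l 1 |Real.sin θ|)⁻¹ θ := fun θ hθ => hasDerivAt_arcsin_sin_rpow hl hθ.1 hθ.2
  have hpos : ∀ θ, 0 ≤ (angularSpeed l 1 |Real.sin θ|)⁻¹ := fun θ =>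
    inv_nonneg.2 (mul_nonneg hl0.le (Real.sqrt_nonneg _))
  have hint := intervalIntegral.intervalIntegrable_deriv_of_nonneg
    (a := 0) (b := Real.pi / 2) (g := fun θ => Real.arcsin (Real.sin θ ^ (1 / l)))
    (g' := fun θ => (angularSpeed l 1 |Real.sin θ|)⁻¹) hc.continuousOn
    (by rwa [min_eq_left (by positivity), max_eq_right (by positivity)])
    (fun θ _ => hpos θ)
  refine ⟨hint, ?_⟩
  rw [intervalIntegral.integral_eq_sub_of_hasDerivAt_of_le (by positivity) hc.continuousOn hd hint]
  have : 1 / l ≠ 0 := by positivity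
  rw [Real.sin_pi_div_two, Real.one_rpow, Real.arcsin_one, Real.sin_zero, Real.zero_rpow this,
    Real.arcsin_zero, sub_zero]

/-- The integrand increases with m, so its value at m = 1, integrable despite the singularity at θ =
0, dominates. -/
lemma tendsto_lifeSpan_one (hl : 1 < l) : Tendsto (lifeSpan l) (𝓝[<] 1) (𝓝 Real.pi) := by
  have hpi := Real.pi_pos
  obtain ⟨hint, hval⟩ := integral_inv_angularSpeed_one hl
  have hev : ∀ᶠ m : ℝ in 𝓝[<] 1, m < 1 := self_mem_nhdsWithin
  have hsin : ∀ᵐ θ : ℝ, θ ∈ uIoc 0 (Real.pi / 2) → 0 < |Real.sin θ| := by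
    filter_upwards with θ hθ
    rw [uIoc_of_le (by positivity)] at hθ
    exact abs_pos.2 (Real.sin_pos_of_pos_of_lt_pi hθ.1 (by linarith [hθ.2])).ne'
  have hlim : Tendsto (fun m => ∫ θ in (0:ℝ)..(Real.pi / 2), (angularSpeed l m |Real.sin θ|)⁻¹)
      (𝓝[<] 1) (𝓝 (∫ θ in (0:ℝ)..(Real.pi / 2), (angularSpeed l 1 |Real.sin θ|)⁻¹)) := by
    refine intervalIntegral.tendsto_integral_filter_of_dominated_convergence
      (fun θ => (angularSpeed l 1 |Real.sin θ|)⁻¹) ?_ ?_ hint ?_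
    · filter_upwards [hev] with m hm
      exact (continuous_inv_angularSpeed hl hm).aestronglyMeasurable
    · filter_upwards [hev] with m hm
      filter_upwards [hsin] with θ hθ hmem
      rw [Real.norm_of_nonneg (inv_pos.2 (angularSpeed_pos hl hm (abs_nonneg _))).le]
      have := massQuot_lt_one hl (hθ hmem)
      exact (inv_angularSpeed_lt hl hm (abs_nonneg _) (by linarith)).le
    · filter_upwards [hsin] with θ hθ hmem
      have h1 := massQuot_lt_one hl (hθ hmem)
      have h2 : 0 < angularSpeed l 1 |Real.sin θ| :=
        mul_pos (by linarith) (Real.sqrt_pos.2 (by linarith))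
      have h3 : Continuous fun m => angularSpeed l m |Real.sin θ| := by
        unfold angularSpeed
        fun_prop
      exact ((h3.tendsto 1).mono_left nhdsWithin_le_nhds).inv₀ h2.ne'
  rw [hval] at hlim
  have := hlim.const_mul 2
  rw [show 2 * (Real.pi / 2) = Real.pi by ring] at this
  refine this.congr' ?_
  filter_upwards [hev] with m hm
  rw [lifeSpan_eq hl hm]

/-! ### The parameters `m` and `r` as functions of the pressure -/

/-- The maximal value of `x` along the hyperbolic orbits with `B = 1`. -/
def apexPos (l P : ℝ) : ℝ := coordInv l √(2 * (pMax l - P))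

/-- The parameter of `lifeSpan` for the hyperbolic orbits with `B = 1`. -/
def paramPos (l P : ℝ) : ℝ := apexPos l P ^ (-2 / l) / l ^ 2

lemma steady_lt_apexPos (hl : 1 < l) {P : ℝ} (hP : P < pMax l) : steady l < apexPos l P := by
  rw [← coordInv_zero hl]
  exact (coordInv_spec hl).2.1 (Real.sqrt_pos.2 (by linarith))

lemma apexPos_pos (hl : 1 < l) {P : ℝ} (hP : P < pMax l) : 0 < apexPos l P :=
  (steady_pos hl).trans (steady_lt_apexPos hl hP)

/-- The turning-point equation V(r) = P_max - P, in the form required by `isLifeSpan_lifeSpan`. It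
also shows that 1 - m has the sign of -P. -/
lemma apexPos_energy (hl : 1 < l) {P : ℝ} (hP : P < pMax l) :
    -2 * P = l ^ 2 * apexPos l P ^ 2 * (1 - paramPos l P) := by
  have hr := apexPos_pos hl hP
  have h1 := coord_sq hl hr.le
  have h0 : 0 < √(2 * pMax l) := Real.sqrt_pos.2 (by linarith [pMax_pos hl])
  rw [apexPos, coord_coordInv hl ((neg_neg_of_pos h0).le.trans (Real.sqrt_nonneg _)),
    Real.sq_sqrt (by linarith), ← apexPos, potential, rpow_mass_exponent hl hr] at h1
  rw [paramPos]
  generalize apexPos l P ^ (-2 / l) = q at *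
  field_simp
  linear_combination h1

lemma paramPos_lt_one (hl : 1 < l) {P : ℝ} (hP : P < 0) : paramPos l P < 1 := by
  have hPm := hP.trans (pMax_pos hl)
  have h1 := apexPos_energy hl hPm
  have h2 := apexPos_pos hl hPm
  have h3 : 0 < l ^ 2 * apexPos l P ^ 2 * (1 - paramPos l P) := by rw [← h1]; linarith
  have := pos_of_mul_pos_right h3 (by positivity)
  linarith

lemma paramPos_zero (hl : 1 < l) : paramPos l 0 = 1 := by
  have h1 := apexPos_energy hl (pMax_pos hl)
  have h2 := apexPos_pos hl (pMax_pos hl)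
  rw [mul_zero, eq_comm, mul_eq_zero] at h1
  have := h1.resolve_left (by positivity)
  linarith

lemma continuousAt_paramPos (hl : 1 < l) {P : ℝ} (hP : P < pMax l) :
    ContinuousAt (paramPos l) P := by
  have h1 : Continuous (apexPos l) := (coordInv_spec hl).1.comp (by fun_prop)
  exact (h1.continuousAt.rpow_const (Or.inl (apexPos_pos hl hP).ne')).div_const _

lemma strictMonoOn_paramPos (hl : 1 < l) : StrictMonoOn (paramPos l) (Iio (pMax l)) := by
  intro P hP P' hP' h
  have h1 : apexPos l P' < apexPos l P :=
    (coordInv_spec hl).2.1 (Real.sqrt_lt_sqrt (by linarith [mem_Iio.1 hP']) (by linarith))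
  have h2 := Real.rpow_lt_rpow_of_neg (apexPos_pos hl hP') h1
    (show -2 / l < 0 from div_neg_of_neg_of_pos (by norm_num) (by linarith))
  exact div_lt_div_of_pos_right h2 (by positivity)

lemma tendsto_rpow_param_atTop (hl : 1 < l) :
    Tendsto (fun r : ℝ => r ^ (-2 / l) / l ^ 2) atTop (𝓝 0) := by
  have h1 := (tendsto_rpow_neg_atTop (show 0 < 2 / l by positivity)).div_const (l ^ 2)
  simpa [neg_div] using h1

lemma tendsto_paramPos_atBot (hl : 1 < l) : Tendsto (paramPos l) atBot (𝓝 0) := by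
  refine (tendsto_rpow_param_atTop hl).comp ((coordInv_spec hl).2.2.2.2.comp
    (Real.tendsto_sqrt_atTop.comp (Tendsto.const_mul_atTop two_pos ?_)))
  exact tendsto_atTop_add_const_left _ _ tendsto_neg_atBot_atTop

/-- For B = -1 the turning point solves λ²r² + r^((2λ-2)/λ) = -2P, whose left side increases from 0
to ∞, so it can be inverted globally. -/
lemma exists_apexNeg (hl : 1 < l) : ∃ R : ℝ → ℝ, Continuous R ∧ StrictMono R ∧ R 0 = 0 ∧
    (∀ p, 0 < p → 0 < R p ∧ l ^ 2 * R p ^ 2 + R p ^ ((2 * l - 2) / l) = p) ∧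
      Tendsto R atTop atTop := by
  have hl0 : 0 < l := by linarith
  obtain ⟨hg, -⟩ := mass_exponent_bounds hl
  set E : ℝ → ℝ := fun r => l ^ 2 * r ^ 2 + r ^ ((2 * l - 2) / l) with hEdef
  have hE0 : E 0 = 0 := by simp [hEdef, Real.zero_rpow hg.ne']
  have hmono : StrictMonoOn E (Ici 0) := by
    intro x hx y hy hxy
    have h1 := Real.rpow_lt_rpow hx hxy hg
    have h2 := pow_lt_pow_left₀ hxy hx two_ne_zero
    have h3 := mul_lt_mul_of_pos_left h2 (show 0 < l ^ 2 by positivity)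
    simp only [hEdef]
    linarith
  have hc : Continuous E := by
    have := Real.continuous_rpow_const hg.le
    fun_prop
  have ht : Tendsto E atTop atTop :=
    ((tendsto_pow_atTop two_ne_zero).const_mul_atTop (by positivity)).atTop_add_atTop
      (tendsto_rpow_atTop hg)
  obtain ⟨R, hR1, hR2, hR3, hR4, hR5⟩ := exists_inverse_Ici hmono hc.continuousOn ht
  have hR0 : R 0 = 0 := by
    have := hR3 0 le_rfl
    rwa [hE0] at this
  refine ⟨R, hR1, hR2, hR0, fun p hp => ⟨?_, (hR4 p (by rw [hE0]; exact hp.le)).2⟩, hR5⟩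
  rw [← hR0]
  exact hR2 hp

/-- The parameter of `lifeSpan` for the hyperbolic orbits with `B = -1`. -/
lemma exists_paramNeg (hl : 1 < l) : ∃ M : ℝ → ℝ,
    (∀ P < 0, M P < 0 ∧ IsLifeSpan l P (-1) (lifeSpan l (M P))) ∧
    ContinuousOn M (Iio 0) ∧ StrictAntiOn M (Iio 0) ∧ Tendsto M (𝓝[<] 0) atBot ∧
    Tendsto M atBot (𝓝 0) := by
  have hl0 : 0 < l := by linarith
  obtain ⟨R, hR1, hR2, hR0, hR4, hR5⟩ := exists_apexNeg hl
  have hexp : -2 / l < 0 := div_neg_of_neg_of_pos (by norm_num) hl0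
  have hpos : ∀ P < 0, 0 < R (-2 * P) := fun P hP => (hR4 _ (by linarith)).1
  refine ⟨fun P => -(R (-2 * P) ^ (-2 / l) / l ^ 2), fun P hP => ?_, fun P hP => ?_, ?_, ?_, ?_⟩
  · have hr := hpos P hP
    have h1 : -(R (-2 * P) ^ (-2 / l) / l ^ 2) < 0 :=
      neg_neg_of_pos (div_pos (Real.rpow_pos_of_pos hr _) (by positivity))
    refine ⟨h1, isLifeSpan_lifeSpan hl hr (by linarith) (by field_simp) ?_⟩
    have h2 := (hR4 (-2 * P) (by linarith)).2
    rw [rpow_mass_exponent hl hr] at h2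
    change -2 * P = l ^ 2 * R (-2 * P) ^ 2 * (1 - -(R (-2 * P) ^ (-2 / l) / l ^ 2))
    generalize R (-2 * P) ^ (-2 / l) = q at *
    generalize R (-2 * P) = r at *
    field_simp
    linear_combination -h2
  · have h1 : Continuous fun P => R (-2 * P) := by fun_prop
    exact ((h1.continuousAt.rpow_const (Or.inl (hpos P hP).ne')).div_const _).neg.continuousWithinAt
  · intro P hP P' hP' h
    have h1 : R (-2 * P') < R (-2 * P) := hR2 (by linarith)
    have h2 := Real.rpow_lt_rpow_of_neg (hpos P' hP') h1 hexp
    exact neg_lt_neg (div_lt_div_of_pos_right h2 (by positivity))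
  · have h1 : Tendsto (fun P => R (-2 * P)) (𝓝[<] 0) (𝓝[>] 0) := by
      refine tendsto_nhdsWithin_iff.2 ⟨?_, ?_⟩
      · have h2 : Continuous fun P => R (-2 * P) := by fun_prop
        have h3 := h2.tendsto 0
        rw [mul_zero, hR0] at h3
        exact h3.mono_left nhdsWithin_le_nhds
      · filter_upwards [self_mem_nhdsWithin] with P hP using hpos P hP
    have h2 : Tendsto (fun r : ℝ => r ^ (-2 / l)) (𝓝[>] 0) atTop :=
      tendsto_rpow_neg_nhdsGT_zero hexp
    exact tendsto_neg_atTop_atBot.comp ((h2.comp h1).atTop_div_const (by positivity))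
  · have h1 : Tendsto (fun P : ℝ => R (-2 * P)) atBot atTop :=
      hR5.comp (tendsto_id.const_mul_atBot_of_neg (by norm_num))
    have := ((tendsto_rpow_param_atTop hl).comp h1).neg
    rwa [neg_zero] at this

lemma isLifeSpan_paramPos (hl : 1 < l) {P : ℝ} (hP : P < 0) :
    IsLifeSpan l P 1 (lifeSpan l (paramPos l P)) := by
  have hPm := hP.trans (pMax_pos hl)
  refine isLifeSpan_lifeSpan hl (apexPos_pos hl hPm) (paramPos_lt_one hl hP) ?_
    (apexPos_energy hl hPm)
  rw [paramPos]
  field_simp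

/-- The energy radius of elliptic orbits. -/
def radius (l P : ℝ) : ℝ := √(2 * (pMax l - P))

lemma radius_mem {P : ℝ} (hP : P ∈ Ioo 0 (pMax l)) : radius l P ∈ Ioo 0 √(2 * pMax l) :=
  ⟨Real.sqrt_pos.2 (by linarith [hP.2]),
    Real.sqrt_lt_sqrt (by linarith [hP.2]) (by linarith [hP.1])⟩

lemma radius_mem_Ico {P : ℝ} (hP : P ∈ Ioo 0 (pMax l)) : radius l P ∈ Ico 0 √(2 * pMax l) :=
  Ioo_subset_Ico_self (radius_mem hP)

lemma continuous_radius : Continuous (radius l) := by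
  unfold radius
  fun_prop

lemma strictAntiOn_radius : StrictAntiOn (radius l) (Ioo 0 (pMax l)) := fun _ _ _ hP' h =>
  Real.sqrt_lt_sqrt (by linarith [hP'.2]) (by linarith)

end

end HomEuler

end

/-! ### Assembly of the elliptic and hyperbolic cases -/

theorem proposition3p1 (lam : ℝ) (hlam : 1 < lam) :
    ∃ T : ℝ → ℝ → ℝ,
      -- `T P B` is the period, respectively the life-span, of the orbits at `(P,B)`
      (∀ P ∈ Ioo 0 (HomEuler.pMax lam), HomEuler.IsPeriod lam P 1 (T P 1)) ∧
      (∀ P < 0, HomEuler.IsLifeSpan lam P 1 (T P 1)) ∧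
      (∀ P < 0, HomEuler.IsLifeSpan lam P (-1) (T P (-1))) ∧
      -- (i) elliptic case
      (4 / 3 ≤ lam →
        ContinuousOn (fun P => T P 1) (Ioo 0 (HomEuler.pMax lam)) ∧
        (2 < lam → StrictAntiOn (fun P => T P 1) (Ioo 0 (HomEuler.pMax lam))) ∧
        (lam = 2 → ∀ P ∈ Ioo 0 (HomEuler.pMax lam), T P 1 = Real.pi) ∧
        (lam < 2 → StrictMonoOn (fun P => T P 1) (Ioo 0 (HomEuler.pMax lam))) ∧
        Tendsto (fun P => T P 1) (𝓝[<] (HomEuler.pMax lam))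
          (𝓝 (2 * Real.pi / Real.sqrt (2 * lam))) ∧
        Tendsto (fun P => T P 1) (𝓝[>] 0) (𝓝 Real.pi)) ∧
      -- (ii) hyperbolic case, `B = 1`
      (ContinuousOn (fun P => T P 1) (Iio 0) ∧
        StrictMonoOn (fun P => T P 1) (Iio 0) ∧
        Tendsto (fun P => T P 1) (𝓝[<] 0) (𝓝 Real.pi) ∧
        Tendsto (fun P => T P 1) atBot (𝓝 (Real.pi / lam))) ∧
      -- (ii) hyperbolic case, `B = -1`
      (ContinuousOn (fun P => T P (-1)) (Iio 0) ∧
        StrictAntiOn (fun P => T P (-1)) (Iio 0) ∧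
        Tendsto (fun P => T P (-1)) (𝓝[<] 0) (𝓝 0) ∧
        Tendsto (fun P => T P (-1)) atBot (𝓝 (Real.pi / lam))) := by
  open HomEuler in
  obtain ⟨M, hM, hMc, hMa, hM0, hMb⟩ := exists_paramNeg hlam
  have hpm := pMax_pos hlam
  -- Values at P = 0, and at P > 0 for B ≠ 1, are arbitrary: no claim involves them.
  set T : ℝ → ℝ → ℝ := fun P B => if 0 < P then ellipticPeriod lam (radius lam P)
    else if B = 1 then lifeSpan lam (paramPos lam P) else lifeSpan lam (M P) with hT
  have hTe : EqOn (fun P => T P 1) (fun P => ellipticPeriod lam (radius lam P))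
      (Ioo 0 (pMax lam)) := fun P hP => if_pos hP.1
  have hTp : EqOn (fun P => T P 1) (fun P => lifeSpan lam (paramPos lam P)) (Iio 0) :=
    fun P hP => by simp [hT, (mem_Iio.1 hP).not_gt]
  have hTm : EqOn (fun P => T P (-1)) (fun P => lifeSpan lam (M P)) (Iio 0) :=
    fun P hP => by
      have : ¬ ((-1 : ℝ) = 1) := by norm_num
      simp [hT, (mem_Iio.1 hP).not_gt, this]
  have hlc : ∀ m < 1, ContinuousAt (lifeSpan lam) m := fun m hm =>
    (continuousOn_lifeSpan hlam).continuousAt (Iio_mem_nhds hm)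
  refine ⟨T, fun P hP => ?_, fun P hP => ?_, fun P hP => ?_, fun hl => ⟨?_, fun h2 => ?_,
    fun h2 P hP => ?_, fun h2 => ?_, ?_, ?_⟩, ⟨?_, ?_, ?_, ?_⟩, ⟨?_, ?_, ?_, ?_⟩⟩
  · rw [show T P 1 = _ from hTe hP]
    exact isPeriod_ellipticPeriod hlam (radius_mem hP).1 (radius_mem hP).2
      (Real.sq_sqrt (by linarith [hP.2]))
  · rw [show T P 1 = _ from hTp hP]
    exact isLifeSpan_paramPos hlam hP
  · rw [show T P (-1) = _ from hTm hP]
    exact (hM P hP).2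
  · exact ((continuousOn_ellipticPeriod hlam).comp continuous_radius.continuousOn
      fun P hP => radius_mem_Ico hP).congr hTe
  -- The radius decreases with P, so monotonicity in r is reversed in P.
  · exact ((strictMonoOn_ellipticPeriod h2).comp_strictAntiOn strictAntiOn_radius
      fun P hP => radius_mem_Ico hP).congr hTe.symm
  · rw [show T P 1 = _ from hTe hP]
    subst h2
    exact ellipticPeriod_two (radius_mem hP).1.le (radius_mem hP).2
  · exact ((strictAntiOn_ellipticPeriod hl h2).comp strictAntiOn_radius
      fun P hP => radius_mem_Ico hP).congr hTe.symm
  -- The period integral makes sense and is continuous at r = 0, so the limit at P_max is its value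
  -- there.
  · have h1 : Tendsto (radius lam) (𝓝[<] (pMax lam)) (𝓝[Ico 0 √(2 * pMax lam)] 0) := by
      refine tendsto_nhdsWithin_iff.2 ⟨?_, ?_⟩
      · have := (continuous_radius (l := lam)).tendsto (pMax lam)
        rw [radius, sub_self, mul_zero, Real.sqrt_zero] at this
        exact this.mono_left nhdsWithin_le_nhds
      · filter_upwards [Ioo_mem_nhdsLT hpm] with P hP using radius_mem_Ico hP
    have h2 := (continuousOn_ellipticPeriod hlam 0 ⟨le_rfl, by positivity⟩).tendsto.comp h1
    rw [ellipticPeriod_zero hlam] at h2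
    refine h2.congr' ?_
    filter_upwards [Ioo_mem_nhdsLT hpm] with P hP using (hTe hP).symm
  · have h1 : Tendsto (radius lam) (𝓝[>] 0) (𝓝[<] √(2 * pMax lam)) := by
      refine tendsto_nhdsWithin_iff.2 ⟨?_, ?_⟩
      · have := (continuous_radius (l := lam)).tendsto 0
        rw [radius, sub_zero] at this
        exact this.mono_left nhdsWithin_le_nhds
      · filter_upwards [Ioo_mem_nhdsGT hpm] with P hP using (radius_mem hP).2
    refine ((tendsto_ellipticPeriod hl).comp h1).congr' ?_
    filter_upwards [Ioo_mem_nhdsGT hpm] with P hP using (hTe hP).symm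
  · exact ContinuousOn.congr (fun P hP => ((hlc _ (paramPos_lt_one hlam hP)).comp
      (continuousAt_paramPos hlam (lt_trans hP hpm))).continuousWithinAt) hTp
  · exact ((strictMonoOn_lifeSpan hlam).comp ((strictMonoOn_paramPos hlam).mono
      (Iio_subset_Iio hpm.le)) fun P hP => paramPos_lt_one hlam hP).congr hTp.symm
  · have h1 : Tendsto (paramPos lam) (𝓝[<] 0) (𝓝[<] 1) := by
      refine tendsto_nhdsWithin_iff.2 ⟨?_, ?_⟩
      · have := (continuousAt_paramPos hlam hpm).tendsto
        rw [paramPos_zero hlam] at this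
        exact this.mono_left nhdsWithin_le_nhds
      · filter_upwards [self_mem_nhdsWithin] with P hP using paramPos_lt_one hlam hP
    refine ((tendsto_lifeSpan_one hlam).comp h1).congr' ?_
    filter_upwards [self_mem_nhdsWithin] with P hP using (hTp hP).symm
  · have h1 := (hlc 0 one_pos).tendsto.comp (tendsto_paramPos_atBot hlam)
    rw [lifeSpan_zero] at h1
    refine h1.congr' ?_
    filter_upwards [eventually_lt_atBot 0] with P hP using (hTp hP).symm
  · exact ContinuousOn.congr ((continuousOn_lifeSpan hlam).comp hMc
      fun P hP => (hM P hP).1.trans one_pos) hTm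
  · exact ((strictMonoOn_lifeSpan hlam).comp_strictAntiOn hMa
      fun P hP => (hM P hP).1.trans one_pos).congr hTm.symm
  · refine ((tendsto_lifeSpan_atBot hlam).comp hM0).congr' ?_
    filter_upwards [self_mem_nhdsWithin] with P hP using (hTm hP).symm
  · have h1 := (hlc 0 one_pos).tendsto.comp hMb
    rw [lifeSpan_zero] at h1
    refine h1.congr' ?_
    filter_upwards [eventually_lt_atBot 0] with P hP using (hTm hP).symm
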